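/- **Setting.** There are $n\ge 1$ clients; client $i$ holds $x_i\in\mathbb R^d$ ($d\ge1$) with $\|x_i\|_2\le c$, where $c>0$, and $\mu=\frac1n\sum_i x_i$. Vectors $u_1,\dots,u_D\in\mathbb R^d$ form a *tight frame* if $\|x\|_2^2=\sum_j\langle u_j,x\rangle^2$ for all $x$. A *Kashin representation of $x$ at level $K$* is an expansion $x=\sum_j a_ju_j$ with $\max_j|a_j|\le \frac{K}{\sqrt D}\|x\|_2$. **Mechanism.** The multi-dimensional Poisson binomial mechanism (PBM) with parameters $m\in\mathbb N$, $\theta\in(0,\frac14]$ and a tight frame $u_1,\dots,u_D$ works as follows. Client $i$ computes, by a fixed rule, a Kashin representation $y_i\in\mathbb R^D$ of $x_i$ at level $K$, so that $\|y_i\|_\infty\le c':=cK/\sqrt d$. It draws independently, for $j=1,\dots,D$, $Z_{ij}\sim\mathrm{Binom}\bigl(m,\tfrac12+\tfrac{\theta}{c'}y_{ij}\bigr)$. Secure aggregation reveals to the server only $\sum_i Z_i\in(\mathbb Z_M)^D$, where $M=nm+1$ is the least modulus for which no overflow occurs. The server outputs $\hat\mu=\sum_j\hat\mu_{y}(j)\,u_j$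 with $\hat\mu_y(j)=\frac{c'}{mn\theta}\bigl(\sum_iZ_{ij}-\frac{mn}{2}\bigr)$. The communication cost per client is $\log_2|(\mathbb Z_M)^D|$ bits. A mechanism is $(\varepsilon,\delta)$-DP if $\Pr(\mathcal M(x)\in S)\le e^{\varepsilon}\Pr(\mathcal M(x')\in S)+\delta$ for all measurable $S$ and all datasets $x,x'$ that differ in the vector of one client. **Theorem.** 1. There are universal constants $\gamma,K>0$ such that for every $d\ge1$ there is a tight frame of $D\le\gamma d$ vectors in $\mathbb R^d$ with respect to which every $x\in\mathbb R^d$ has a Kashin representation at level $K$. 2. Let $\gamma,K>0$. There is $C_1>0$ depending only on $\gamma,K$, and for every $B>0$ there is $\kappa_0\in(0,1]$ depending only on $\gamma,K,B$, such that for every $\kappa\in(0,\kappa_0]$ and $\delta\in(0,1)$ there is $C_2>0$ depending only on $\gamma,K,B,\kappa,\delta$ with the following property. For all $n,d\ge1$, $c>0$, all $\varepsilon$ with $0<\varepsilon\le B\log(1/\delta)$, and every tight frame of $D\le\gamma d$ vectors in $\mathbb R^d$ with respect to which every $x$ with $\|x\|_2\le c$ has a Kashin representation at level $K$, the PBM with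 $$\theta=\kappa\min\Bigl(\tfrac14,\sqrt{\tfrac{n\varepsilon^2}{d\log(1/\delta)}}\Bigr),\qquad m=\Bigl\lceil\tfrac{n\varepsilon^2}{d\log(1/\delta)}\Bigr\rceil$$ satisfies: - it is $(\varepsilon,\delta)$-DP, both for the aggregate $\sum_iZ_i$ seen by the server and for the output $\hat\mu$; - if $n\ge2$, its communication cost per client is at most $C_1\,d\log_2\bigl(n+\frac{n\varepsilon^2}{d\log(1/\delta)}\bigr)$ bits; - $\hat\mu$ is square-integrable, $\mathbb E[\hat\mu]=\mu$ and $\mathbb E\|\hat\mu-\mu\|_2^2\le C_2\,\frac{c^2d}{n^2\varepsilon^2}$. -/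

import Mathlib

open MeasureTheory ProbabilityTheory

noncomputable section

/-- `ℝ^d` with the Euclidean norm. -/
abbrev Vec (d : ℕ) : Type := EuclideanSpace ℝ (Fin d)

/-! ### Tight frames and Kashin representations -/

/-- Vectors `u_1, …, u_D` of `ℝ^d` form a tight frame if Parseval's identity holds. -/
def IsTightFrame {d D : ℕ} (u : Fin D → Vec d) : Prop :=
  ∀ x : Vec d, ‖x‖ ^ 2 = ∑ j, (inner ℝ (u j) x) ^ 2

/-- `x = ∑ a_j u_j` is a Kashin representation of `x` at level `K`. -/
def IsKashinRep {d D : ℕ} (u : Fin D → Vec d) (K : ℝ) (x : Vec d) (a : Fin D → ℝ) : Prop :=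
  x = ∑ j, a j • u j ∧ ∀ j, |a j| ≤ K / √(D : ℝ) * ‖x‖

/-! ### Differential privacy -/

/-- A randomized mechanism, given by the law `M x` of its output on the dataset `x`, is
`(ε, δ)`-differentially private with respect to the neighboring relation `nbr`. -/
def IsApproxDP {X Y : Type*} [MeasurableSpace Y] (nbr : X → X → Prop) (M : X → Measure Y)
    (ε δ : ℝ) : Prop :=
  ∀ x x' : X, nbr x x' → ∀ S : Set Y, MeasurableSet S →
    (M x).real S ≤ Real.exp ε * (M x').real S + δ

/-- The data of `n` clients: one vector each, in the ball of radius `c`. -/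
abbrev Dataset (n d : ℕ) (c : ℝ) : Type := {x : Fin n → Vec d // ∀ i, ‖x i‖ ≤ c}

/-- Two datasets are neighbors if they differ in the data of at most one client. -/
def Neighboring {n d : ℕ} {c : ℝ} (x x' : Dataset n d c) : Prop :=
  ∃ i, ∀ k, k ≠ i → x.1 k = x'.1 k

/-- The mean of the clients' vectors. -/
def datasetMean {n d : ℕ} {c : ℝ} (x : Dataset n d c) : Vec d :=
  (n : ℝ)⁻¹ • ∑ i, x.1 i

/-! ### The Poisson binomial mechanism -/

/-- The scalar mechanism: the law `Binom(m, p)` with `p = (θ / c') y + 1 / 2`.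
The projection to `[0, 1]` does nothing when `|y| ≤ c'` and `0 ≤ θ ≤ 1 / 2`. -/
def scalarPBM (m : ℕ) (θ c' y : ℝ) : Measure ℕ :=
  binomial m (Set.projIcc (0 : ℝ) 1 zero_le_one (θ / c' * y + 1 / 2))

/-- The inputs of the multi-dimensional Poisson binomial mechanism other than the data:
the parameters `m`, `θ`, the radius `c`, the frame `u`, its Kashin level `K`, and the map `rep`
by which a client computes the coefficients of its vector. -/
structure PBM (d D : ℕ) where
  m : ℕ
  θ : ℝ
  c : ℝ
  K : ℝ
  u : Fin D → Vec d
  rep : Vec d → Fin D → ℝ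

namespace PBM

variable {d D : ℕ} (A : PBM d D)

/-- The bound `c' = c K / √d` on the coefficients. -/
def c' : ℝ := A.c * A.K / √(d : ℝ)

/-- The joint law of the messages `Z_{ij}`: independent over clients `i` and coordinates `j`. -/
def messages {n : ℕ} (x : Dataset n d A.c) : Measure (Fin n → Fin D → ℕ) :=
  Measure.pi fun i => Measure.pi fun j => scalarPBM A.m A.θ A.c' (A.rep (x.1 i) j)

/-- Modulus of secure aggregation: the least one for which the sum of `n` messages
in `{0, …, m}` cannot overflow. -/
abbrev modulus (n : ℕ) : ℕ := n * A.m + 1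

/-- The group `(ℤ_M)^D` in which each client's message is encoded. -/
abbrev MsgGroup (n : ℕ) : Type := Fin D → ZMod (A.modulus n)

/-- Secure aggregation: coordinatewise sum modulo `M`. -/
def secAgg {n : ℕ} (z : Fin n → Fin D → ℕ) : A.MsgGroup n :=
  fun j => ∑ i, (z i j : ZMod (A.modulus n))

/-- The law of what the server sees. -/
def aggLaw {n : ℕ} (x : Dataset n d A.c) : Measure (A.MsgGroup n) :=
  (A.messages x).map A.secAgg

/-- The server's estimate: `μ̂_y = c' / (m n θ) (∑ Z_i - m n / 2)` and `μ̂ = U μ̂_y`. -/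
def decode {n : ℕ} (s : A.MsgGroup n) : Vec d :=
  ∑ j, (A.c' / (A.m * n * A.θ) * (((s j).val : ℝ) - A.m * n / 2)) • A.u j

/-- The law of the output `μ̂` of the mechanism. -/
def outputLaw {n : ℕ} (x : Dataset n d A.c) : Measure (Vec d) :=
  (A.aggLaw x).map A.decode

/-- Communication cost per client in bits: `log₂` of the size of the message group. -/
def commBits (n : ℕ) : ℝ := Real.logb 2 (Nat.card (A.MsgGroup n))

end PBM

/-! ### The choice of parameters -/

/-- `n ε² / (d log (1 / δ))`. -/
def privacyRatio (n d : ℕ) (ε δ : ℝ) : ℝ := n * ε ^ 2 / (d * Real.log (1 / δ))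

/-- The mechanism with `θ = κ min (1/4, √(n ε² / (d log (1/δ))))` and
`m = ⌈n ε² / (d log (1/δ))⌉`. -/
def tunedPBM {d D : ℕ} (n : ℕ) (κ ε δ c K : ℝ) (u : Fin D → Vec d) (rep : Vec d → Fin D → ℝ) :
    PBM d D where
  m := ⌈privacyRatio n d ε δ⌉₊
  θ := κ * min (1 / 4) (√(privacyRatio n d ε δ))
  c := c
  K := K
  u := u
  rep := rep

end

noncomputable section

open Polynomial Finset

/-! Privacy. The sum revealed in one coordinate has the coefficients of `(∏ i, bernPoly (p i)) ^ m`
as its law: the `n m` trials regroup into `m` Poisson binomials of `n` trials, in each of which a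
change of one client alters a single parameter, by at most `2 θ`. `RenyiBound l A B c` bounds the
exponential form of the Rényi divergence of order `l + 1`. It is multiplicative under products of
polynomials (sums of independent variables) and stable under mixtures, both by the same Hölder
inequality. For a single Poisson binomial, every Bernoulli with parameter in `[1/4, 3/4]` is a
mixture of those with parameters `1/4` and `3/4`. One may thus assume that the other clients use
only these two values, and discard the less frequent one. What remains is a Bernoulli plus a
binomial with at least about `n / 2` trials. There the likelihood ratio is Lipschitz in the
normalized count, and symmetrization turns its moments into exponential moments of a difference of
two independent counts (`RenyiBound.bernPoly_mul_pow`). The resulting factor `exp (O((l θ)² / n))`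
is raised to the power `m D` and converted to `(ε, δ)`-privacy with `l` about `2 log (1/δ) / ε`;
this succeeds because `m θ² ≤ κ² n ε² / (d log (1/δ))` with `κ` small. Accuracy. Synthesis by a
tight frame is a contraction, so the squared error is at most the sum of `D` scalar variances, each
of order `c'² / (n m θ²)`, and `m θ²` is also bounded below by a multiple of the same ratio. Frames.
Counting sign matrices over nets yields a `400 d × d` matrix with operator norm `O(√d)` that still
does not shrink the `ℓ¹` norm (`exists_good_signs`). Its rescaled rows, completed by `d` further
vectors, form a tight frame, and Hahn–Banach turns the `ℓ¹` lower bound into uniformly small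
coefficients. -/

/-! ### A Hölder inequality -/

/-- Jensen for `x ↦ x ^ (l + 1)` at the points `a i / b i` with weights `b i / ∑ b`. Since `l ≠ 0`,
a vanishing `b i` forces `a i = 0`, so such terms do no harm. -/
theorem sum_pow_succ_le_sum_mul_sum_pow {ι : Type*} (s : Finset ι) {l : ℕ} (hl : l ≠ 0)
    (a b h : ι → ℝ) (ha : ∀ i ∈ s, 0 ≤ a i) (hb : ∀ i ∈ s, 0 ≤ b i) (hh : ∀ i ∈ s, 0 ≤ h i)
    (hab : ∀ i ∈ s, a i ^ (l + 1) ≤ h i * b i ^ l) :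
    (∑ i ∈ s, a i) ^ (l + 1) ≤ (∑ i ∈ s, h i) * (∑ i ∈ s, b i) ^ l := by
  have hz : ∀ i ∈ s, b i = 0 → a i = 0 := fun i hi h0 => by
    have := hab i hi
    rw [h0, zero_pow hl, mul_zero] at this
    exact pow_eq_zero_iff (Nat.succ_ne_zero l) |>.1
      (le_antisymm this (pow_nonneg (ha i hi) _))
  rcases (sum_nonneg hb).eq_or_lt with h0 | hpos
  · have hb0 := (sum_eq_zero_iff_of_nonneg hb).1 h0.symm
    rw [sum_eq_zero fun i hi => hz i hi (hb0 i hi), zero_pow (Nat.succ_ne_zero l)]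
    exact mul_nonneg (sum_nonneg hh) (pow_nonneg (sum_nonneg hb) _)
  · set S := ∑ i ∈ s, b i with hS
    have key := Real.pow_arith_mean_le_arith_mean_pow s (fun i => b i / S) (fun i => a i / b i)
      (fun i hi => div_nonneg (hb i hi) hpos.le)
      (by rw [← sum_div, ← hS, div_self hpos.ne'])
      (fun i hi => div_nonneg (ha i hi) (hb i hi)) (l + 1)
    have e1 : ∑ i ∈ s, b i / S * (a i / b i) = (∑ i ∈ s, a i) / S := by
      rw [sum_div]
      refine sum_congr rfl fun i hi => ?_
      by_cases hbi : b i = 0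
      · simp [hbi, hz i hi hbi]
      · field_simp
    have e2 : ∑ i ∈ s, b i / S * (a i / b i) ^ (l + 1) ≤ (∑ i ∈ s, h i) / S := by
      rw [sum_div]
      refine sum_le_sum fun i hi => ?_
      by_cases hbi : b i = 0
      · simpa [hbi] using div_nonneg (hh i hi) hpos.le
      · have hbp : 0 < b i := lt_of_le_of_ne (hb i hi) (Ne.symm hbi)
        have : b i / S * (a i / b i) ^ (l + 1) = a i ^ (l + 1) / b i ^ l / S := by
          rw [div_pow, pow_succ (b i)]
          field_simp
        rw [this]
        gcongr
        rw [div_le_iff₀ (by positivity)]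
        exact hab i hi
    rw [e1] at key
    have := key.trans e2
    rw [div_pow, div_le_div_iff₀ (by positivity) hpos, pow_succ S, ← mul_assoc] at this
    exact le_of_mul_le_mul_right this hpos

/-! ### Rényi bounds for generating polynomials -/

/-- The weights given by the coefficients of `A` and `B` satisfy
`∑ A_k ^ (l + 1) / B_k ^ l ≤ c`, stated without division. -/
structure RenyiBound (l : ℕ) (A B : ℝ[X]) (c : ℝ) : Prop where
  nonneg_left : ∀ k, 0 ≤ A.coeff k
  nonneg_right : ∀ k, 0 ≤ B.coeff k
  exists_bound : ∃ H : ℝ[X], (∀ k, 0 ≤ H.coeff k) ∧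
    (∀ k, A.coeff k ^ (l + 1) ≤ H.coeff k * B.coeff k ^ l) ∧ H.eval 1 ≤ c

theorem coeff_mul_nonneg {A B : ℝ[X]} (hA : ∀ k, 0 ≤ A.coeff k) (hB : ∀ k, 0 ≤ B.coeff k) (k : ℕ) :
    0 ≤ (A * B).coeff k := by
  rw [coeff_mul]
  exact sum_nonneg fun x _ => mul_nonneg (hA _) (hB _)

theorem eval_nonneg_of_coeff_nonneg {A : ℝ[X]} (hA : ∀ k, 0 ≤ A.coeff k) {x : ℝ} (hx : 0 ≤ x) :
    0 ≤ A.eval x := by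
  rw [eval_eq_sum]
  exact sum_nonneg fun k _ => mul_nonneg (hA k) (pow_nonneg hx k)

namespace RenyiBound

variable {l : ℕ} {A B A' B' : ℝ[X]} {c c' : ℝ}

theorem nonneg (h : RenyiBound l A B c) : 0 ≤ c := by
  obtain ⟨H, h0, -, h2⟩ := h.exists_bound
  exact (eval_nonneg_of_coeff_nonneg h0 zero_le_one).trans h2

theorem mono (h : RenyiBound l A B c) (hc : c ≤ c') : RenyiBound l A B c' := by
  obtain ⟨H, h0, h1, h2⟩ := h.exists_bound
  exact ⟨h.1, h.2, H, h0, h1, h2.trans hc⟩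

theorem refl (hA : ∀ k, 0 ≤ A.coeff k) (h1 : A.eval 1 = 1) : RenyiBound l A A 1 :=
  ⟨hA, hA, A, hA, fun k => by rw [pow_succ'], h1.le⟩

/-- Tensorization and data processing at once: the bound multiplies over pairs of exponents, and
Hölder on each antidiagonal passes from the pair to its sum. `H * H'` is again a witness. -/
theorem mul (hl : l ≠ 0) (h : RenyiBound l A B c) (h' : RenyiBound l A' B' c') :
    RenyiBound l (A * A') (B * B') (c * c') := by
  obtain ⟨H, h0, h1, h2⟩ := h.exists_bound
  obtain ⟨H', h0', h1', h2'⟩ := h'.exists_bound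
  refine ⟨coeff_mul_nonneg h.1 h'.1, coeff_mul_nonneg h.2 h'.2, H * H',
    coeff_mul_nonneg h0 h0', fun k => ?_, ?_⟩
  · simp only [coeff_mul]
    refine sum_pow_succ_le_sum_mul_sum_pow _ hl _ _ _ (fun i _ => mul_nonneg (h.1 _) (h'.1 _))
      (fun i _ => mul_nonneg (h.2 _) (h'.2 _)) (fun i _ => mul_nonneg (h0 _) (h0' _))
      fun i _ => ?_
    rw [mul_pow, mul_pow, mul_mul_mul_comm]
    exact mul_le_mul (h1 _) (h1' _) (pow_nonneg (h'.1 _) _)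
      (mul_nonneg (h0 _) (pow_nonneg (h.2 _) _))
  · rw [eval_mul]
    exact mul_le_mul h2 h2' (eval_nonneg_of_coeff_nonneg h0' zero_le_one) h.nonneg

theorem pow (hl : l ≠ 0) (h : RenyiBound l A B c) (m : ℕ) :
    RenyiBound l (A ^ m) (B ^ m) (c ^ m) := by
  induction m with
  | zero =>
    simp only [pow_zero]
    refine refl (fun k => ?_) (by simp)
    rw [coeff_one]; split_ifs <;> norm_num
  | succ m ih => simpa only [pow_succ] using ih.mul hl h

/-- Joint quasi-convexity: forgetting which component of a mixture was drawn cannot increase the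
divergence. This is Hölder over two terms. -/
theorem convexComb (hl : l ≠ 0) (h : RenyiBound l A B c) (h' : RenyiBound l A' B' c) {t s : ℝ}
    (ht : 0 ≤ t) (hs : 0 ≤ s) (hts : t + s = 1) :
    RenyiBound l (C t * A + C s * A') (C t * B + C s * B') c := by
  obtain ⟨H, h0, h1, h2⟩ := h.exists_bound
  obtain ⟨H', h0', h1', h2'⟩ := h'.exists_bound
  have nn : ∀ {P Q : ℝ[X]}, (∀ k, 0 ≤ P.coeff k) → (∀ k, 0 ≤ Q.coeff k) →
      ∀ k, 0 ≤ (C t * P + C s * Q).coeff k := fun hP hQ k => by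
    simp only [coeff_add, coeff_C_mul]
    exact add_nonneg (mul_nonneg ht (hP k)) (mul_nonneg hs (hQ k))
  refine ⟨nn h.1 h'.1, nn h.2 h'.2, C t * H + C s * H', nn h0 h0', fun k => ?_, ?_⟩
  · have := sum_pow_succ_le_sum_mul_sum_pow (univ : Finset (Fin 2)) hl
      ![t * A.coeff k, s * A'.coeff k] ![t * B.coeff k, s * B'.coeff k]
      ![t * H.coeff k, s * H'.coeff k]
      (by simp [Fin.forall_fin_two, mul_nonneg, *, h.1 k, h'.1 k])
      (by simp [Fin.forall_fin_two, mul_nonneg, *, h.2 k, h'.2 k])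
      (by simp [Fin.forall_fin_two, mul_nonneg, *])
      (by
        have aux : ∀ {r a b d : ℝ}, 0 ≤ r → a ^ (l + 1) ≤ d * b ^ l →
            (r * a) ^ (l + 1) ≤ r * d * (r * b) ^ l := fun {r a b d} hr hab => by
          rw [mul_pow, mul_pow, mul_mul_mul_comm, ← pow_succ']
          exact mul_le_mul_of_nonneg_left hab (by positivity)
        simp only [mem_univ, forall_const, Fin.forall_fin_two]
        exact ⟨aux ht (h1 k), aux hs (h1' k)⟩)
    simpa [Fin.sum_univ_two] using this
  · simp only [eval_add, eval_mul, eval_C]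
    calc _ ≤ t * c + s * c := by gcongr
      _ = c := by rw [← add_mul, hts, one_mul]

end RenyiBound

/-! ### The Bernoulli generating polynomial -/

/-- The generating polynomial of the Bernoulli distribution. -/
def bernPoly (p : ℝ) : ℝ[X] := C (1 - p) + C p * X

theorem bernPoly_eval (p z : ℝ) : (bernPoly p).eval z = 1 - p + p * z := by simp [bernPoly]

theorem bernPoly_coeff_nonneg {p : ℝ} (h0 : 0 ≤ p) (h1 : p ≤ 1) (k : ℕ) :
    0 ≤ (bernPoly p).coeff k := by
  simp only [bernPoly, coeff_add, coeff_C_mul, coeff_C, coeff_X]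
  split_ifs <;> simp <;> linarith

theorem bernPoly_pow_coeff_nonneg {p : ℝ} (h0 : 0 ≤ p) (h1 : p ≤ 1) (m k : ℕ) :
    0 ≤ (bernPoly p ^ m).coeff k := by
  induction m generalizing k with
  | zero => rw [pow_zero, coeff_one]; positivity
  | succ m ih => rw [pow_succ]; exact coeff_mul_nonneg ih (bernPoly_coeff_nonneg h0 h1) k

theorem bernPoly_natDegree_le (p : ℝ) : (bernPoly p).natDegree ≤ 1 := by
  unfold bernPoly; compute_degree

/-- The left side is the moment generating function of a difference of two independent Bernoulli
variables; as `2 p (1 - p) ≤ 1/2`, it is at most `cosh t`. -/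
theorem bernPoly_mul_eval_exp_le (p t : ℝ) :
    (bernPoly p).eval (Real.exp t) * (bernPoly p).eval (Real.exp (-t)) ≤ Real.exp (t ^ 2 / 2) := by
  refine le_trans ?_ (Real.cosh_le_exp_half_sq t)
  have hc := Real.one_le_cosh t
  have he : Real.exp t * Real.exp (-t) = 1 := by rw [← Real.exp_add]; simp
  rw [bernPoly_eval, bernPoly_eval]
  have : (1 - p + p * Real.exp t) * (1 - p + p * Real.exp (-t)) =
      1 + 2 * (p * (1 - p)) * (Real.cosh t - 1) := by
    rw [Real.cosh_eq]; linear_combination p ^ 2 * he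
  rw [this]
  nlinarith [sq_nonneg (p - 1 / 2), mul_nonneg (sub_nonneg.2 hc) (sq_nonneg (p - 1 / 2))]

/-- A Bernoulli variable added to a binomial one, compared with the binomial variable with one more
trial. -/
theorem bernPoly_mul_pow_coeff (p : ℝ) {q : ℝ} (hq0 : q ≠ 0) (hq1 : 1 - q ≠ 0) (g k : ℕ) :
    (bernPoly p * bernPoly q ^ g).coeff k =
      (bernPoly q ^ (g + 1)).coeff k *
        ((1 - p) / (1 - q) + (p / q - (1 - p) / (1 - q)) * (k / (g + 1))) := by
  have hg : (g : ℝ) + 1 ≠ 0 := by positivity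
  have hd : derivative (bernPoly q ^ (g + 1)) = C ((g + 1) * q) * bernPoly q ^ g := by
    rw [derivative_pow_succ]
    simp [bernPoly]
    ring
  have hX : (X * derivative (bernPoly q ^ (g + 1))).coeff k
      = k * (bernPoly q ^ (g + 1)).coeff k := by
    cases k with
    | zero => simp
    | succ k => rw [coeff_X_mul, coeff_derivative]; push_cast; ring
  -- Write `bernPoly p` as a combination of `bernPoly q` and `X`. After multiplication by `bernPoly
  -- q ^ g`, the second term is a multiple of `X` times the derivative of `bernPoly q ^ (g + 1)`,
  -- which brings the factor `k` into the coefficient.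
  have hid : bernPoly p * bernPoly q ^ g =
      C ((1 - p) / (1 - q)) * bernPoly q ^ (g + 1) +
        C ((p / q - (1 - p) / (1 - q)) / (g + 1)) * (X * derivative (bernPoly q ^ (g + 1))) := by
    have e1 : bernPoly p = C ((1 - p) / (1 - q)) * bernPoly q
        + C ((p / q - (1 - p) / (1 - q)) * q) * X := by
      unfold bernPoly
      rw [mul_add, ← C_mul, ← mul_assoc, ← C_mul, add_assoc, ← add_mul, ← C_add]
      congr 3 <;> field_simp
      ring
    have e2 : C ((p / q - (1 - p) / (1 - q)) * q)
        = C ((p / q - (1 - p) / (1 - q)) / (g + 1)) * C (((g : ℝ) + 1) * q) := by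
      rw [← C_mul]; congr 1; field_simp
    rw [hd]
    conv_lhs => rw [e1, e2]
    ring
  rw [hid, coeff_add, coeff_C_mul, coeff_C_mul, hX]
  field_simp

/-- Symmetrization: a centered function which is Lipschitz with respect to `x` has exponential
moments controlled by those of a difference of two independent copies of `x`. -/
theorem sum_mul_pow_le_sum_sum_exp {ι : Type*} (s : Finset ι) (w r x : ι → ℝ) (M : ℝ) (a : ℕ)
    (hw : ∀ i ∈ s, 0 ≤ w i) (hw1 : ∑ i ∈ s, w i = 1) (hr : ∀ i ∈ s, 0 ≤ r i)
    (hwr : ∑ i ∈ s, w i * r i = 1)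
    (hlip : ∀ i ∈ s, ∀ j ∈ s, |r i - r j| ≤ M * |x i - x j|) :
    ∑ i ∈ s, w i * r i ^ a ≤ ∑ i ∈ s, ∑ j ∈ s, w i * w j * Real.exp (a * M * (x i - x j)) := by
  -- Exchanging the two copies replaces `exp` by `cosh`, which is monotone in the absolute value of
  -- its argument; only then can the Lipschitz bound be inserted.
  have symm : ∀ y : ι → ℝ, ∑ i ∈ s, ∑ j ∈ s, w i * w j * Real.exp (y i - y j) =
      ∑ i ∈ s, ∑ j ∈ s, w i * w j * Real.cosh (y i - y j) := fun y => by
    have : ∑ i ∈ s, ∑ j ∈ s, w i * w j * Real.exp (y i - y j) =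
        ∑ i ∈ s, ∑ j ∈ s, w i * w j * Real.exp (-(y i - y j)) := by
      rw [sum_comm]
      refine sum_congr rfl fun i _ => sum_congr rfl fun j _ => ?_
      rw [neg_sub, mul_comm (w j)]
    simp only [Real.cosh_eq, mul_div_assoc', mul_add, add_div, sum_add_distrib, ← sum_div]
    rw [← this]; ring
  -- `r` has mean 1, so by `1 + x ≤ exp x` this factor is at least 1, and an independent copy can be
  -- multiplied in for free.
  have h1 : 1 ≤ ∑ j ∈ s, w j * Real.exp (-(a * (r j - 1))) := by
    calc (1 : ℝ) = ∑ j ∈ s, w j * (-(a * (r j - 1)) + 1) := by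
          have : ∀ j, w j * (-(a * (r j - 1)) + 1) = (a + 1) * w j - a * (w j * r j) :=
            fun j => by ring
          simp only [this, sum_sub_distrib, ← mul_sum, hw1, hwr]; ring
      _ ≤ _ := sum_le_sum fun j hj => mul_le_mul_of_nonneg_left (Real.add_one_le_exp _) (hw j hj)
  calc ∑ i ∈ s, w i * r i ^ a ≤ ∑ i ∈ s, w i * Real.exp (a * (r i - 1)) := by
        refine sum_le_sum fun i hi => mul_le_mul_of_nonneg_left ?_ (hw i hi)
        rw [Real.exp_nat_mul]
        refine pow_le_pow_left₀ (hr i hi) ?_ _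
        linarith [Real.add_one_le_exp (r i - 1)]
    _ ≤ (∑ i ∈ s, w i * Real.exp (a * (r i - 1))) *
          ∑ j ∈ s, w j * Real.exp (-(a * (r j - 1))) :=
        le_mul_of_one_le_right (sum_nonneg fun i hi => mul_nonneg (hw i hi) (Real.exp_nonneg _)) h1
    _ = ∑ i ∈ s, ∑ j ∈ s, w i * w j * Real.exp (a * r i - a * r j) := by
        rw [sum_mul_sum]
        refine sum_congr rfl fun i _ => sum_congr rfl fun j _ => ?_
        rw [mul_mul_mul_comm, ← Real.exp_add]; congr 2; ring
    _ = ∑ i ∈ s, ∑ j ∈ s, w i * w j * Real.cosh (a * r i - a * r j) := symm fun i => a * r i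
    _ ≤ ∑ i ∈ s, ∑ j ∈ s, w i * w j * Real.cosh (a * M * x i - a * M * x j) := by
        refine sum_le_sum fun i hi => sum_le_sum fun j hj =>
          mul_le_mul_of_nonneg_left ?_ (mul_nonneg (hw i hi) (hw j hj))
        rw [Real.cosh_le_cosh, ← mul_sub, ← mul_sub, abs_mul, abs_mul, abs_mul, mul_assoc]
        gcongr
        exact (hlip i hi j hj).trans (mul_le_mul_of_nonneg_right (le_abs_self M) (abs_nonneg _))
    _ = ∑ i ∈ s, ∑ j ∈ s, w i * w j * Real.exp (a * M * (x i - x j)) := by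
        rw [← symm fun i => a * M * x i]; simp only [mul_sub]

theorem sum_range_coeff_mul_exp {A : ℝ[X]} {n : ℕ} (hn : A.natDegree < n) (t : ℝ) :
    ∑ k ∈ range n, A.coeff k * Real.exp (t * k) = A.eval (Real.exp t) := by
  rw [eval_eq_sum_range' hn]
  refine sum_congr rfl fun k _ => ?_
  rw [mul_comm t, Real.exp_nat_mul]

/-- The density of a Bernoulli plus a binomial variable relative to a binomial one. -/
def bernRatio (p q f : ℝ) : ℝ := (1 - p) / (1 - q) + (p / q - (1 - p) / (1 - q)) * f

theorem one_third_le_bernRatio {p q f : ℝ} (hp : p ∈ Set.Icc (1 / 4 : ℝ) (3 / 4))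
    (hq : q ∈ Set.Icc (1 / 4 : ℝ) (3 / 4)) (hf : f ∈ Set.Icc (0 : ℝ) 1) :
    1 / 3 ≤ bernRatio p q f := by
  obtain ⟨hp0, hp1⟩ := hp
  obtain ⟨hq0, hq1⟩ := hq
  have h1 : 1 / 3 ≤ p / q := by rw [le_div_iff₀ (by linarith)]; linarith
  have h2 : 1 / 3 ≤ (1 - p) / (1 - q) := by rw [le_div_iff₀ (by linarith)]; linarith
  unfold bernRatio
  nlinarith [hf.1, hf.2, mul_nonneg (sub_nonneg.2 h1) hf.1,
    mul_nonneg (sub_nonneg.2 h2) (sub_nonneg.2 hf.2)]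

/-- In a difference of two values of a quotient of affine functions the numerator is a determinant,
here `(p - p') (f - f') / (q (1 - q))`. The constant 48 is `(16/3) * 9`, from `q (1 - q) ≥ 3/16` and
denominators of at least `1/3`. -/
theorem bernRatio_div_lipschitz {p p' q f f' Δ : ℝ}
    (hp' : p' ∈ Set.Icc (1 / 4 : ℝ) (3 / 4)) (hq : q ∈ Set.Icc (1 / 4 : ℝ) (3 / 4))
    (hΔ : |p - p'| ≤ Δ) (hf : f ∈ Set.Icc (0 : ℝ) 1) (hf' : f' ∈ Set.Icc (0 : ℝ) 1) :
    |bernRatio p q f / bernRatio p' q f - bernRatio p q f' / bernRatio p' q f'|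
      ≤ 48 * Δ * |f - f'| := by
  have a1 := one_third_le_bernRatio hp' hq hf
  have a2 := one_third_le_bernRatio hp' hq hf'
  obtain ⟨hq0, hq1⟩ := hq
  have q0 : q ≠ 0 := by linarith
  have q1 : 1 - q ≠ 0 := by linarith
  have hqq : 3 / 16 ≤ q * (1 - q) := by nlinarith
  have d1 : bernRatio p' q f ≠ 0 := by linarith
  have d2 : bernRatio p' q f' ≠ 0 := by linarith
  have hdd : 1 / 9 ≤ bernRatio p' q f * bernRatio p' q f' := by nlinarith
  have e : bernRatio p q f / bernRatio p' q f - bernRatio p q f' / bernRatio p' q f' =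
      (p - p') * (f - f') / ((q * (1 - q)) * (bernRatio p' q f * bernRatio p' q f')) := by
    rw [div_sub_div _ _ d1 d2, div_eq_div_iff (mul_ne_zero d1 d2)
      (mul_ne_zero (mul_ne_zero q0 q1) (mul_ne_zero d1 d2))]
    have : (bernRatio p q f * bernRatio p' q f' - bernRatio p' q f * bernRatio p q f') *
        (q * (1 - q)) = (p - p') * (f - f') := by
      unfold bernRatio
      field_simp
      ring
    linear_combination (bernRatio p' q f * bernRatio p' q f') * this
  have hpos : 0 < (q * (1 - q)) * (bernRatio p' q f * bernRatio p' q f') :=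
    mul_pos (by linarith) (by linarith)
  rw [e, abs_div, abs_mul, abs_of_pos hpos, div_le_iff₀ hpos]
  have h48 : 1 / 48 ≤ (q * (1 - q)) * (bernRatio p' q f * bernRatio p' q f') := by
    nlinarith
  have hΔ0 := (abs_nonneg _).trans hΔ
  calc |p - p'| * |f - f'| ≤ Δ * |f - f'| := by gcongr
    _ = 48 * Δ * |f - f'| * (1 / 48) := by ring
    _ ≤ _ := by gcongr

/-- The witness is the second law times the `(l + 1)`-th power of the likelihood ratio.
Symmetrization bounds its mass by a product of `g + 1` Bernoulli factors, each at most `exp (τ ^ 2 /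
2)` with `τ = (l + 1) (48 Δ) / (g + 1)`. -/
theorem RenyiBound.bernPoly_mul_pow {p p' q Δ : ℝ} (hp : p ∈ Set.Icc (1 / 4 : ℝ) (3 / 4))
    (hp' : p' ∈ Set.Icc (1 / 4 : ℝ) (3 / 4)) (hq : q ∈ Set.Icc (1 / 4 : ℝ) (3 / 4))
    (hΔ : |p - p'| ≤ Δ) (l g : ℕ) :
    RenyiBound l (bernPoly p * bernPoly q ^ g) (bernPoly p' * bernPoly q ^ g)
      (Real.exp (((l + 1) * (48 * Δ)) ^ 2 / (2 * (g + 1)))) := by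
  have q0 : q ≠ 0 := by linarith [hq.1]
  have q1 : 1 - q ≠ 0 := by linarith [hq.2]
  have hg : (0 : ℝ) < g + 1 := by positivity
  have nn : ∀ {x : ℝ}, x ∈ Set.Icc (1 / 4 : ℝ) (3 / 4) →
      ∀ k, 0 ≤ (bernPoly x * bernPoly q ^ g).coeff k := fun hx =>
    coeff_mul_nonneg (bernPoly_coeff_nonneg (by linarith [hx.1]) (by linarith [hx.2]))
      (bernPoly_pow_coeff_nonneg (by linarith [hq.1]) (by linarith [hq.2]) g)
  have deg : ∀ x : ℝ, (bernPoly x * bernPoly q ^ g).natDegree < g + 2 := fun x => by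
    have h1 := natDegree_mul_le (p := bernPoly x) (q := bernPoly q ^ g)
    have h2 := natDegree_pow_le (p := bernPoly q) (n := g)
    have h3 := bernPoly_natDegree_le x
    have h4 := Nat.mul_le_mul_left g (bernPoly_natDegree_le q)
    omega
  have tot : ∀ x : ℝ, ∑ k ∈ range (g + 2), (bernPoly x * bernPoly q ^ g).coeff k = 1 := fun x => by
    have := eval_eq_sum_range' (deg x) 1
    simpa [bernPoly_eval] using this.symm
  set f : ℕ → ℝ := fun k => k / (g + 1) with hf
  have hfI : ∀ k ∈ range (g + 2), f k ∈ Set.Icc (0 : ℝ) 1 := fun k hk => by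
    refine ⟨by positivity, ?_⟩
    rw [hf, div_le_one hg]
    have := mem_range.1 hk
    exact_mod_cast (by omega : k ≤ g + 1)
  have hc : ∀ x k, (bernPoly x * bernPoly q ^ g).coeff k =
      (bernPoly q ^ (g + 1)).coeff k * bernRatio x q (f k) :=
    fun x k => bernPoly_mul_pow_coeff x q0 q1 g k
  set r : ℕ → ℝ := fun k => bernRatio p q (f k) / bernRatio p' q (f k) with hr
  have hrel : ∀ k ∈ range (g + 2), (bernPoly p' * bernPoly q ^ g).coeff k * r k =
      (bernPoly p * bernPoly q ^ g).coeff k := fun k hk => by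
    have := one_third_le_bernRatio hp' hq (hfI k hk)
    rw [hc p, hc p', hr]
    field_simp
  have hr0 : ∀ k ∈ range (g + 2), 0 ≤ r k := fun k hk => by
    have h1 := one_third_le_bernRatio hp hq (hfI k hk)
    have h2 := one_third_le_bernRatio hp' hq (hfI k hk)
    exact div_nonneg (by linarith) (by linarith)
  have hH : ∀ k, (∑ j ∈ range (g + 2),
      monomial j ((bernPoly p' * bernPoly q ^ g).coeff j * r j ^ (l + 1))).coeff k =
      if k ∈ range (g + 2) then (bernPoly p' * bernPoly q ^ g).coeff k * r k ^ (l + 1) else 0 :=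
    fun k => by simp only [finsetSum_coeff, coeff_monomial, sum_ite_eq']
  refine ⟨nn hp, nn hp', ∑ j ∈ range (g + 2), monomial j
    ((bernPoly p' * bernPoly q ^ g).coeff j * r j ^ (l + 1)), fun k => ?_, fun k => ?_, ?_⟩
  · rw [hH]
    split_ifs with hk
    · exact mul_nonneg (nn hp' k) (pow_nonneg (hr0 k hk) _)
    · exact le_rfl
  · rw [hH]
    split_ifs with hk
    · rw [← hrel k hk, mul_pow]; apply le_of_eq; ring
    · rw [coeff_eq_zero_of_natDegree_lt, zero_pow (Nat.succ_ne_zero l), zero_mul]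
      have := deg p
      rw [mem_range] at hk
      omega
  · simp only [eval_finsetSum, eval_monomial, one_pow, mul_one]
    refine (sum_mul_pow_le_sum_sum_exp (range (g + 2))
      (fun k => (bernPoly p' * bernPoly q ^ g).coeff k) r f (48 * Δ) (l + 1)
      (fun k _ => nn hp' k) (tot p') hr0 ((sum_congr rfl hrel).trans (tot p))
      fun i hi j hj => bernRatio_div_lipschitz hp' hq hΔ (hfI i hi) (hfI j hj)).trans ?_
    set τ : ℝ := (l + 1) * (48 * Δ) / (g + 1) with hτ
    have e : ∑ i ∈ range (g + 2), ∑ j ∈ range (g + 2),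
        (bernPoly p' * bernPoly q ^ g).coeff i * (bernPoly p' * bernPoly q ^ g).coeff j *
          Real.exp (↑(l + 1) * (48 * Δ) * (f i - f j)) =
        (bernPoly p' * bernPoly q ^ g).eval (Real.exp τ) *
          (bernPoly p' * bernPoly q ^ g).eval (Real.exp (-τ)) := by
      rw [← sum_range_coeff_mul_exp (deg p'), ← sum_range_coeff_mul_exp (deg p'), sum_mul_sum]
      refine sum_congr rfl fun i _ => sum_congr rfl fun j _ => ?_
      rw [mul_mul_mul_comm, ← Real.exp_add]
      congr 2
      rw [hf, hτ]; push_cast; ring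
    rw [e, eval_mul, eval_mul, eval_pow, eval_pow, mul_mul_mul_comm, ← mul_pow]
    have ev0 : ∀ x : ℝ, x ∈ Set.Icc (1 / 4 : ℝ) (3 / 4) →
        ∀ t : ℝ, 0 ≤ (bernPoly x).eval (Real.exp t) := fun x hx t =>
      eval_nonneg_of_coeff_nonneg
        (bernPoly_coeff_nonneg (by linarith [hx.1]) (by linarith [hx.2])) (Real.exp_nonneg _)
    calc _ ≤ Real.exp (τ ^ 2 / 2) * Real.exp (τ ^ 2 / 2) ^ g := by
          gcongr
          · exact pow_nonneg (mul_nonneg (ev0 q hq _) (ev0 q hq _)) _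
          · exact bernPoly_mul_eval_exp_le p' τ
          · exact mul_nonneg (ev0 q hq _) (ev0 q hq _)
          · exact bernPoly_mul_eval_exp_le q τ
      _ = Real.exp (((l + 1) * (48 * Δ)) ^ 2 / (2 * (g + 1))) := by
          rw [← Real.exp_nat_mul, ← Real.exp_add, hτ]
          congr 1
          field_simp
          ring

theorem bernPoly_eq_convexComb (p : ℝ) :
    bernPoly p = C (2 * (3 / 4 - p)) * bernPoly (1 / 4) + C (2 * (p - 1 / 4)) * bernPoly (3 / 4) := by
  ext k
  simp only [bernPoly, coeff_add, coeff_C_mul, coeff_C, coeff_X]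
  split_ifs <;> ring

/-- `RenyiBound.bernPoly_mul_pow` needs equal parameters in the remaining trials. Splitting each
factor into parameters `1/4` and `3/4` moves it from `s` into `g₁` or `g₂`, leaving `s.card + g₁ +
g₂` fixed. Once `s` is empty, the larger group is kept: `2 (max g₁ g₂ + 1) ≥ g₁ + g₂ + 1`. -/
theorem RenyiBound.bernPoly_mul_prod_aux {p p' Δ : ℝ} (hp : p ∈ Set.Icc (1 / 4 : ℝ) (3 / 4))
    (hp' : p' ∈ Set.Icc (1 / 4 : ℝ) (3 / 4)) (hΔ : |p - p'| ≤ Δ) {l : ℕ} (hl : l ≠ 0)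
    {ι : Type*} (s : Finset ι) (P : ι → ℝ) (hP : ∀ i ∈ s, P i ∈ Set.Icc (1 / 4 : ℝ) (3 / 4))
    (g₁ g₂ : ℕ) :
    RenyiBound l (bernPoly p * (bernPoly (1 / 4) ^ g₁ * bernPoly (3 / 4) ^ g₂ * ∏ i ∈ s, bernPoly (P i)))
      (bernPoly p' * (bernPoly (1 / 4) ^ g₁ * bernPoly (3 / 4) ^ g₂ * ∏ i ∈ s, bernPoly (P i)))
      (Real.exp (((l + 1) * (48 * Δ)) ^ 2 / (s.card + g₁ + g₂ + 1))) := by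
  classical
  induction s using Finset.induction generalizing g₁ g₂ with
  | empty =>
    have h14 : (1 / 4 : ℝ) ∈ Set.Icc (1 / 4 : ℝ) (3 / 4) := by norm_num
    have h34 : (3 / 4 : ℝ) ∈ Set.Icc (1 / 4 : ℝ) (3 / 4) := by norm_num
    have rfl' : ∀ q ∈ Set.Icc (1 / 4 : ℝ) (3 / 4), ∀ g,
        RenyiBound l (bernPoly q ^ g) (bernPoly q ^ g) 1 := fun q hq g =>
      .refl (bernPoly_pow_coeff_nonneg (by linarith [hq.1]) (by linarith [hq.2]) g)
        (by simp [bernPoly_eval])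
    simp only [prod_empty, mul_one, card_empty, Nat.cast_zero, zero_add]
    rcases le_total g₂ g₁ with h | h
    · have := (RenyiBound.bernPoly_mul_pow hp hp' h14 hΔ l g₁).mul hl (rfl' _ h34 g₂)
      rw [mul_assoc, mul_assoc, mul_one] at this
      refine this.mono (Real.exp_le_exp.2 ?_)
      gcongr
      have : (g₂ : ℝ) ≤ g₁ := by exact_mod_cast h
      linarith
    · have := (RenyiBound.bernPoly_mul_pow hp hp' h34 hΔ l g₂).mul hl (rfl' _ h14 g₁)
      rw [mul_assoc, mul_assoc, mul_one, mul_comm (bernPoly (3 / 4) ^ g₂)] at this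
      refine this.mono (Real.exp_le_exp.2 ?_)
      gcongr
      have : (g₁ : ℝ) ≤ g₂ := by exact_mod_cast h
      linarith
  | insert i s hi ih =>
    have hs := fun j hj => hP j (mem_insert_of_mem hj)
    have hPi := hP i (mem_insert_self i s)
    have e1 : (((insert i s).card : ℕ) : ℝ) = s.card + 1 := by
      rw [card_insert_of_notMem hi]; push_cast; ring
    have h1 := (ih hs (g₁ + 1) g₂).mono (c' := Real.exp (((l + 1) * (48 * Δ)) ^ 2 /
        ((insert i s).card + g₁ + g₂ + 1))) (le_of_eq (by rw [e1]; push_cast; ring_nf))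
    have h2 := (ih hs g₁ (g₂ + 1)).mono (c' := Real.exp (((l + 1) * (48 * Δ)) ^ 2 /
        ((insert i s).card + g₁ + g₂ + 1))) (le_of_eq (by rw [e1]; push_cast; ring_nf))
    have key := h1.convexComb hl h2 (t := 2 * (3 / 4 - P i)) (s := 2 * (P i - 1 / 4))
      (by linarith [hPi.2]) (by linarith [hPi.1]) (by ring)
    have e : ∀ A : ℝ[X],
        A * (bernPoly (1 / 4) ^ g₁ * bernPoly (3 / 4) ^ g₂ * ∏ j ∈ insert i s, bernPoly (P j)) =
        C (2 * (3 / 4 - P i)) * (A * (bernPoly (1 / 4) ^ (g₁ + 1) * bernPoly (3 / 4) ^ g₂ *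
          ∏ j ∈ s, bernPoly (P j))) +
        C (2 * (P i - 1 / 4)) * (A * (bernPoly (1 / 4) ^ g₁ * bernPoly (3 / 4) ^ (g₂ + 1) *
          ∏ j ∈ s, bernPoly (P j))) := fun A => by
      rw [prod_insert hi, bernPoly_eq_convexComb (P i)]; ring
    rwa [← e, ← e] at key

/-- The Poisson binomial distribution of `n` trials satisfies a Rényi bound of order `1 / n` when
the parameter of one trial changes. -/
theorem RenyiBound.prod_bernPoly {n : ℕ} {P P' : Fin n → ℝ} {Δ : ℝ} {l : ℕ} (hl : l ≠ 0)
    (hP : ∀ i, P i ∈ Set.Icc (1 / 4 : ℝ) (3 / 4)) (hP' : ∀ i, P' i ∈ Set.Icc (1 / 4 : ℝ) (3 / 4))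
    (i₀ : Fin n) (hne : ∀ i, i ≠ i₀ → P i = P' i) (hΔ : |P i₀ - P' i₀| ≤ Δ) :
    RenyiBound l (∏ i, bernPoly (P i)) (∏ i, bernPoly (P' i))
      (Real.exp (((l + 1) * (48 * Δ)) ^ 2 / n)) := by
  have key := RenyiBound.bernPoly_mul_prod_aux (hP i₀) (hP' i₀) hΔ hl (univ.erase i₀) P
    (fun i _ => hP i) 0 0
  have hcard : (((univ.erase i₀).card : ℕ) : ℝ) + 1 = n := by
    rw [card_erase_of_mem (mem_univ _), card_univ, Fintype.card_fin]
    have := i₀.pos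
    exact_mod_cast (by omega : n - 1 + 1 = n)
  have e : ∏ i ∈ univ.erase i₀, bernPoly (P i) = ∏ i ∈ univ.erase i₀, bernPoly (P' i) :=
    prod_congr rfl fun i hi => by rw [hne i (ne_of_mem_erase hi)]
  simp only [pow_zero, one_mul, Nat.cast_zero, add_zero, hcard] at key
  rwa [mul_prod_erase univ (fun i => bernPoly (P i)) (mem_univ i₀), e,
    mul_prod_erase univ (fun i => bernPoly (P' i)) (mem_univ i₀)] at key

/-! ### From polynomials to measures -/

theorem Polynomial.coeff_prod_univ {ι : Type*} [Fintype ι] [DecidableEq ι] (f : ι → ℝ[X]) (k : ℕ) :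
    (∏ i, f i).coeff k = ∑ z ∈ piAntidiag univ k, ∏ i, (f i).coeff (z i) := by
  rw [← Polynomial.coeff_coe, ← Polynomial.coeToPowerSeries.ringHom_apply, map_prod,
    PowerSeries.coeff_prod]
  refine sum_nbij' (fun z => ⇑z) (fun z => Finsupp.equivFunOnFinite.symm z) ?_ ?_ ?_ ?_ ?_
  · intro z hz
    simp only [mem_finsuppAntidiag, mem_piAntidiag] at hz ⊢
    exact ⟨hz.1, fun _ _ => mem_univ _⟩
  · intro z hz
    simp only [mem_finsuppAntidiag, mem_piAntidiag] at hz ⊢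
    exact ⟨hz.1, subset_univ _⟩
  · intro z _; ext; rfl
  · intro z _; rfl
  · intro z _
    simp [Polynomial.coeToPowerSeries.ringHom_apply]

/-- `ν` is the measure on `ℕ` with generating polynomial `A`. -/
def HasGenPoly (ν : Measure ℕ) (A : ℝ[X]) : Prop := ∀ k, ν {k} = ENNReal.ofReal (A.coeff k)

theorem exists_hasGenPoly (H : ℝ[X]) :
    ∃ η : Measure ℕ, IsFiniteMeasure η ∧ HasGenPoly η H ∧
      η Set.univ = ∑ k ∈ H.support, ENNReal.ofReal (H.coeff k) := by
  refine ⟨∑ k ∈ H.support, ENNReal.ofReal (H.coeff k) • Measure.dirac k, ?_, fun j => ?_, ?_⟩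
  · refine ⟨?_⟩
    simp [ENNReal.ofReal_lt_top]
  · rw [Measure.finsetSum_apply]
    simp only [Measure.smul_apply, smul_eq_mul, MeasurableSpace.measurableSet_top,
      Measure.dirac_apply', Set.indicator_apply, Set.mem_singleton_iff, Pi.one_apply, mul_ite,
      mul_one, mul_zero, sum_ite_eq', mem_support_iff]
    split_ifs with h
    · rfl
    · rw [not_not.1 h]; simp
  · simp

theorem HasGenPoly.map_sum {n : ℕ} {ν : Fin n → Measure ℕ} [∀ i, IsProbabilityMeasure (ν i)]
    {f : Fin n → ℝ[X]} (h : ∀ i, HasGenPoly (ν i) (f i)) (hf : ∀ i k, 0 ≤ (f i).coeff k) :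
    HasGenPoly ((Measure.pi ν).map fun z => ∑ i, z i) (∏ i, f i) := fun k => by
  have hs : (fun z : Fin n → ℕ => ∑ i, z i) ⁻¹' {k} = (piAntidiag univ k : Finset (Fin n → ℕ)) := by
    ext z; simp
  rw [Measure.map_apply (by fun_prop) (by simp), hs, ← sum_measure_singleton, coeff_prod_univ,
    ENNReal.ofReal_sum_of_nonneg fun z _ => prod_nonneg fun i _ => hf i _]
  refine sum_congr rfl fun z _ => ?_
  rw [Measure.pi_singleton, ENNReal.ofReal_prod_of_nonneg fun i _ => hf i _]
  exact prod_congr rfl fun i _ => h i _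

theorem hasGenPoly_binomial (m : ℕ) (p : unitInterval) :
    HasGenPoly (binomial m p) (bernPoly p ^ m) := fun k => by
  rw [binomial_singleton]
  congr 1
  have e : bernPoly p = C (p : ℝ) * X + C (1 - (p : ℝ)) := by rw [bernPoly, add_comm]
  rw [e, add_pow, finsetSum_coeff]
  have : ∀ j, ((C (p : ℝ) * X) ^ j * C (1 - (p : ℝ)) ^ (m - j) * (m.choose j : ℝ[X])).coeff k =
      if k = j then (m.choose j : ℝ) * p ^ j * (1 - p) ^ (m - j) else 0 := fun j => by
    have : (C (p : ℝ) * X) ^ j * C (1 - (p : ℝ)) ^ (m - j) * (m.choose j : ℝ[X]) =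
        C ((m.choose j : ℝ) * p ^ j * (1 - p) ^ (m - j)) * X ^ j := by
      simp only [C_mul, C_pow, map_natCast, mul_pow]; ring
    rw [this, coeff_C_mul_X_pow]
  simp only [this, sum_ite_eq, mem_range]
  split_ifs with hk
  · rfl
  · rw [Nat.choose_eq_zero_of_lt (by omega)]; simp

theorem measure_le_of_singleton_le {α : Type*} [MeasurableSpace α] [Countable α]
    [MeasurableSingletonClass α] {μ ν : Measure α} (h : ∀ a, μ {a} ≤ ν {a}) : μ ≤ ν := by
  refine Measure.le_iff.2 fun s hs => ?_
  rw [← Measure.tsum_indicator_apply_singleton μ s hs, ← Measure.tsum_indicator_apply_singleton ν s hs]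
  exact ENNReal.tsum_le_tsum fun a => Set.indicator_le_indicator (h a)

/-- A Rényi bound for each coordinate of a random vector with independent coordinates gives
approximate differential privacy. -/
theorem RenyiBound.measure_pi_le {D l : ℕ} {ν ν' : Fin D → Measure ℕ}
    [∀ i, IsProbabilityMeasure (ν i)] [∀ i, IsProbabilityMeasure (ν' i)] {A B : Fin D → ℝ[X]}
    (hν : ∀ j, HasGenPoly (ν j) (A j)) (hν' : ∀ j, HasGenPoly (ν' j) (B j)) {c : ℝ}
    (h : ∀ j, RenyiBound l (A j) (B j) c) (ε : ℝ) (S : Set (Fin D → ℕ)) :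
    (Measure.pi ν).real S ≤ Real.exp ε * (Measure.pi ν').real S + Real.exp (-(ε * l)) * c ^ D := by
  choose H h0 h1 h2 using fun j => (h j).exists_bound
  choose η ηfin hη ηtot using fun j => exists_hasGenPoly (H j)
  -- The inequality is proved atom by atom. Where the first law exceeds `exp ε` times the second,
  -- substituting `q ≤ exp (-ε) p` into `p ^ (l + 1) ≤ r q ^ l` gives `p ≤ exp (-(ε l)) r`.
  have hle : Measure.pi ν ≤ ENNReal.ofReal (Real.exp ε) • Measure.pi ν' +
      ENNReal.ofReal (Real.exp (-(ε * l))) • Measure.pi η := by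
    refine measure_le_of_singleton_le fun s => ?_
    rw [Measure.add_apply, Measure.smul_apply, Measure.smul_apply, Measure.pi_singleton,
      Measure.pi_singleton, Measure.pi_singleton, prod_congr rfl fun j _ => hν j (s j),
      prod_congr rfl fun j _ => hν' j (s j), prod_congr rfl fun j _ => hη j (s j),
      ← ENNReal.ofReal_prod_of_nonneg fun j _ => (h j).1 _,
      ← ENNReal.ofReal_prod_of_nonneg fun j _ => (h j).2 _,
      ← ENNReal.ofReal_prod_of_nonneg fun j _ => h0 j _, smul_eq_mul, smul_eq_mul,
      ← ENNReal.ofReal_mul (Real.exp_nonneg _), ← ENNReal.ofReal_mul (Real.exp_nonneg _)]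
    have qn : 0 ≤ ∏ j, (B j).coeff (s j) := prod_nonneg fun j _ => (h j).2 _
    have hn : 0 ≤ ∏ j, (H j).coeff (s j) := prod_nonneg fun j _ => h0 j _
    have pn : 0 ≤ ∏ j, (A j).coeff (s j) := prod_nonneg fun j _ => (h j).1 _
    rw [← ENNReal.ofReal_add (by positivity) (by positivity)]
    refine ENNReal.ofReal_le_ofReal ?_
    have key : (∏ j, (A j).coeff (s j)) ^ (l + 1) ≤
        (∏ j, (H j).coeff (s j)) * (∏ j, (B j).coeff (s j)) ^ l := by
      rw [← prod_pow, ← prod_pow, ← prod_mul_distrib]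
      exact prod_le_prod (fun j _ => pow_nonneg ((h j).1 _) _) fun j _ => h1 j _
    generalize ∏ j, (A j).coeff (s j) = p at *
    generalize ∏ j, (B j).coeff (s j) = q at *
    generalize ∏ j, (H j).coeff (s j) = r at *
    by_cases hpq : p ≤ Real.exp ε * q
    · have : 0 ≤ Real.exp (-(ε * l)) * r := by positivity
      linarith
    · have hq : q ≤ Real.exp (-ε) * p := by
        rw [Real.exp_neg, inv_mul_eq_div, le_div_iff₀ (Real.exp_pos _)]
        linarith
      have hp : 0 < p := lt_of_le_of_lt (by positivity) (not_le.1 hpq)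
      have : p * p ^ l ≤ (Real.exp (-(ε * l)) * r) * p ^ l := by
        rw [← pow_succ']
        refine key.trans ?_
        calc r * q ^ l ≤ r * (Real.exp (-ε) * p) ^ l := by gcongr
          _ = _ := by
            rw [mul_pow, ← Real.exp_nat_mul]
            ring_nf
      have := le_of_mul_le_mul_right this (by positivity)
      have : 0 ≤ Real.exp ε * q := by positivity
      linarith
  have hmass : (Measure.pi η).real S ≤ c ^ D := by
    refine (measureReal_mono (Set.subset_univ S)).trans ?_
    rw [measureReal_def, Measure.pi_univ, ENNReal.toReal_prod]
    calc ∏ j, (η j Set.univ).toReal ≤ ∏ _j : Fin D, c := by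
          refine prod_le_prod (fun _ _ => ENNReal.toReal_nonneg) fun j _ => ?_
          rw [ηtot, ← ENNReal.ofReal_sum_of_nonneg fun k _ => h0 j k,
            ENNReal.toReal_ofReal (sum_nonneg fun k _ => h0 j k)]
          refine le_trans (le_of_eq ?_) (h2 j)
          rw [eval_eq_sum, Polynomial.sum]
          simp
      _ = c ^ D := by simp
  have := hle S
  rw [Measure.add_apply, Measure.smul_apply, Measure.smul_apply, smul_eq_mul, smul_eq_mul] at this
  have := ENNReal.toReal_mono (by finiteness) this
  rw [ENNReal.toReal_add (by finiteness) (by finiteness), ENNReal.toReal_mul, ENNReal.toReal_mul,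
    ENNReal.toReal_ofReal (Real.exp_nonneg _), ENNReal.toReal_ofReal (Real.exp_nonneg _)] at this
  exact this.trans (add_le_add le_rfl (mul_le_mul_of_nonneg_left hmass (Real.exp_nonneg _)))

theorem IsApproxDP.map {X Y Z : Type*} [MeasurableSpace Y] [MeasurableSpace Z] {nbr : X → X → Prop}
    {M : X → Measure Y} {ε δ : ℝ} (h : IsApproxDP nbr M ε δ) {f : Y → Z} (hf : Measurable f) :
    IsApproxDP nbr (fun x => (M x).map f) ε δ := fun x x' hx S hS => by
  simp only [map_measureReal_apply hf hS]
  exact h x x' hx _ (hf hS)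

/-! ### The law of the coordinatewise sums and its privacy -/

namespace PBM

variable {d D n : ℕ} (A : PBM d D)

/-- The success probability of the messages of a client with data `v` in coordinate `j`. -/
def prob (v : Vec d) (j : Fin D) : unitInterval :=
  Set.projIcc (0 : ℝ) 1 zero_le_one (A.θ / A.c' * A.rep v j + 1 / 2)

/-- The law of the sums over the clients, before reduction modulo `M`. -/
def sumLaw (x : Dataset n d A.c) : Measure (Fin D → ℕ) :=
  Measure.pi fun j => (Measure.pi fun i => binomial A.m (A.prob (x.1 i) j)).map fun z => ∑ i, z i

theorem measurable_sum : Measurable fun z : Fin n → ℕ => ∑ i, z i := by fun_prop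

instance (x : Dataset n d A.c) (j : Fin D) : IsProbabilityMeasure
    ((Measure.pi fun i => binomial A.m (A.prob (x.1 i) j)).map fun z => ∑ i, z i) :=
  Measure.isProbabilityMeasure_map measurable_sum.aemeasurable

instance (x : Dataset n d A.c) : IsProbabilityMeasure (A.sumLaw x) := by
  unfold sumLaw; infer_instance

instance (x : Dataset n d A.c) (i : Fin n) (j : Fin D) :
    IsProbabilityMeasure (scalarPBM A.m A.θ A.c' (A.rep (x.1 i) j)) := by
  unfold scalarPBM; infer_instance

theorem map_sum_messages (x : Dataset n d A.c) :
    (A.messages x).map (fun z j => ∑ i, z i j) = A.sumLaw x := by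
  have swap : (A.messages x).map (fun z j i => z i j) =
      Measure.pi fun j => Measure.pi fun i => binomial A.m (A.prob (x.1 i) j) := by
    refine Measure.ext_of_singleton fun a => ?_
    have : (fun (z : Fin n → Fin D → ℕ) j i => z i j) ⁻¹' {a} = {fun i j => a j i} := by
      ext z
      simp only [Set.mem_preimage, Set.mem_singleton_iff, funext_iff]
      exact forall_comm
    rw [Measure.map_apply (by fun_prop) (by simp), this, messages]
    simp only [Measure.pi_singleton]
    exact prod_comm
  have : (fun (z : Fin n → Fin D → ℕ) j => ∑ i, z i j) =
      (fun (z : Fin D → Fin n → ℕ) j => ∑ i, z j i) ∘ fun z j i => z i j := rfl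
  rw [this, ← Measure.map_map (by fun_prop) (by fun_prop), swap]
  exact Measure.pi_map_pi (X := fun _ => Fin n → ℕ) (f := fun _ z => ∑ i, z i)
    fun j => measurable_sum.aemeasurable

/-- Reduction modulo `M`. -/
def reduce (n : ℕ) (s : Fin D → ℕ) : A.MsgGroup n := fun j => (s j : ZMod (A.modulus n))

theorem aggLaw_eq_map_sumLaw (x : Dataset n d A.c) :
    A.aggLaw x = (A.sumLaw x).map (A.reduce n) := by
  rw [← map_sum_messages, Measure.map_map (measurable_of_countable _) (by fun_prop), aggLaw]
  congr 1
  funext z j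
  simp [secAgg, reduce]

theorem hasGenPoly_sumLaw (x : Dataset n d A.c) (j : Fin D) :
    HasGenPoly ((Measure.pi fun i => binomial A.m (A.prob (x.1 i) j)).map fun z => ∑ i, z i)
      ((∏ i, bernPoly (A.prob (x.1 i) j)) ^ A.m) := by
  rw [← prod_pow]
  exact HasGenPoly.map_sum (fun i => hasGenPoly_binomial _ _) fun i k =>
    bernPoly_pow_coeff_nonneg (A.prob _ j).2.1 (A.prob _ j).2.2 _ _

/-- Two probabilities within `Δ` of `1/2` differ by at most `2 Δ`, whence `96 = 2 * 48`. The
exponent collects one factor `m` from the trials and one factor `D` from the coordinates. The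
server's view and the output are functions of these sums and inherit the bound. -/
theorem isApproxDP_sumLaw {Δ : ℝ} {l : ℕ} (hl : l ≠ 0)
    (hp : ∀ v : Vec d, ‖v‖ ≤ A.c → ∀ j, (A.prob v j : ℝ) ∈ Set.Icc (1 / 4 : ℝ) (3 / 4) ∧
      |(A.prob v j : ℝ) - 1 / 2| ≤ Δ) {ε δ : ℝ}
    (hδ : Real.exp (-(ε * l)) * Real.exp (A.m * D * (((l + 1) * (96 * Δ)) ^ 2 / n)) ≤ δ) :
    IsApproxDP Neighboring (fun x : Dataset n d A.c => A.sumLaw x) ε δ := by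
  rintro x x' ⟨i₀, hi₀⟩ S -
  refine (RenyiBound.measure_pi_le (l := l) (A.hasGenPoly_sumLaw x) (A.hasGenPoly_sumLaw x')
    (c := Real.exp (((l + 1) * (48 * (2 * Δ))) ^ 2 / n) ^ A.m) (fun j => ?_) ε S).trans ?_
  · refine (RenyiBound.prod_bernPoly hl (fun i => (hp _ (x.2 i) j).1)
      (fun i => (hp _ (x'.2 i) j).1) i₀ (fun i hi => by rw [hi₀ i hi]) ?_).pow hl _
    have h1 := abs_le.1 (hp _ (x.2 i₀) j).2
    have h2 := abs_le.1 (hp _ (x'.2 i₀) j).2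
    exact abs_le.2 ⟨by linarith [h1.1, h2.2], by linarith [h1.2, h2.1]⟩
  · refine add_le_add le_rfl (le_trans (le_of_eq ?_) hδ)
    rw [← Real.exp_nat_mul, ← Real.exp_nat_mul]
    congr 2
    ring

end PBM

/-! ### Tight frames -/

/-- Synthesis is the adjoint of the isometric analysis map; concretely, Cauchy–Schwarz applied to
`‖v‖ ^ 2 = ∑ j, b j * inner ℝ (u j) v`. -/
theorem IsTightFrame.norm_sum_smul_sq_le {d D : ℕ} {u : Fin D → Vec d} (hu : IsTightFrame u)
    (b : Fin D → ℝ) : ‖∑ j, b j • u j‖ ^ 2 ≤ ∑ j, b j ^ 2 := by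
  set v := ∑ j, b j • u j with hv
  have h1 : ‖v‖ ^ 2 = ∑ j, b j * inner ℝ (u j) v := by
    rw [← real_inner_self_eq_norm_sq]
    conv_lhs => rw [hv, sum_inner]
    exact sum_congr rfl fun j _ => real_inner_smul_left _ _ _
  have h2 : (‖v‖ ^ 2) * (‖v‖ ^ 2) ≤ (∑ j, b j ^ 2) * ‖v‖ ^ 2 := by
    have := sum_mul_sq_le_sq_mul_sq univ b fun j => inner ℝ (u j) v
    rwa [← h1, ← hu v, sq (‖v‖ ^ 2)] at this
  rcases (sq_nonneg ‖v‖).eq_or_lt with h0 | h0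
  · rw [← h0]; exact sum_nonneg fun j _ => sq_nonneg _
  · exact le_of_mul_le_mul_right h2 h0

/-- Needed to pass from the Kashin bound, with `√D`, to `c'`, which has `√d`. -/
theorem IsTightFrame.dim_le {d D : ℕ} {u : Fin D → Vec d} (hu : IsTightFrame u) : d ≤ D := by
  have := LinearMap.finrank_le_finrank_of_injective
    (f := LinearMap.pi fun j => (innerₛₗ ℝ (u j) : Vec d →ₗ[ℝ] ℝ)) (by
      rw [injective_iff_map_eq_zero]
      intro x hx
      have h : ∀ j, inner ℝ (u j) x = 0 := fun j => congrFun hx j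
      have := hu x
      simpa [h] using this)
  simpa using this

/-! ### Moments of binomial variables -/

theorem Nat.Iic_eq_range_succ (m : ℕ) : Finset.Iic m = Finset.range (m + 1) := by
  ext; simp

/-- Binomial weights are values of Bernstein polynomials, so the mean and the variance are
evaluations of polynomial identities. -/
theorem integral_id_binomial (m : ℕ) (p : unitInterval) :
    ∫ k, (k : ℝ) ∂(binomial m p) = m * p := by
  have := congrArg (Polynomial.eval (p : ℝ)) (bernsteinPolynomial.sum_smul ℝ m)
  rw [integral_binomial, Nat.Iic_eq_range_succ]
  simpa [bernsteinPolynomial, eval_finsetSum, mul_comm] using this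

theorem variance_binomial (m : ℕ) (p : unitInterval) :
    Var[fun k : ℕ => (k : ℝ); binomial m p] = m * p * (1 - p) := by
  have := congrArg (Polynomial.eval (p : ℝ)) (bernsteinPolynomial.variance ℝ m)
  rw [variance_eq_integral (by fun_prop), integral_id_binomial, integral_binomial,
    Nat.Iic_eq_range_succ]
  simp only [eval_finsetSum, bernsteinPolynomial, nsmul_eq_mul, eval_mul, eval_pow, eval_sub,
    eval_natCast, eval_X, eval_one] at this
  rw [← this]
  refine sum_congr rfl fun k _ => ?_
  rw [smul_eq_mul]; ring

theorem memLp_binomial (m : ℕ) (p : unitInterval) (q : ENNReal) :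
    MemLp (fun k : ℕ => (k : ℝ)) q (binomial m p) := by
  refine MemLp.of_bound (by fun_prop) m ?_
  have := ae_le_of_hasLaw_binomial (HasLaw.id (μ := binomial m p))
  filter_upwards [this] with k hk
  simpa using hk

section PoissonBinomial

variable {n m : ℕ} (p : Fin n → unitInterval)

theorem integral_sum_pi_binomial :
    ∫ z, ((∑ i, z i : ℕ) : ℝ) ∂(Measure.pi fun i => binomial m (p i)) = m * ∑ i, (p i : ℝ) := by
  push_cast
  have hmp := fun i => measurePreserving_eval (fun i => binomial m (p i)) i
  have hint : ∀ i, Integrable (fun z : Fin n → ℕ => (z i : ℝ)) (Measure.pi fun i => binomial m (p i)) :=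
    fun i => (hmp i).integrable_comp_of_integrable (integrable_binomial fun k : ℕ => (k : ℝ))
  rw [integral_finsetSum _ fun i _ => hint i, mul_sum]
  refine sum_congr rfl fun i _ => ?_
  rw [← integral_id_binomial, ← (hmp i).map_eq,
    integral_map (measurable_pi_apply i).aemeasurable (by fun_prop)]

theorem integral_sum_pi_binomial_sub_sq :
    ∫ z, (((∑ i, z i : ℕ) : ℝ) - m * ∑ i, (p i : ℝ)) ^ 2 ∂(Measure.pi fun i => binomial m (p i)) =
      ∑ i, m * (p i : ℝ) * (1 - p i) := by
  have h := variance_sum_pi (μ := fun i => binomial m (p i)) (X := fun _ k => (k : ℝ))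
    fun i => memLp_binomial m (p i) 2
  simp only [variance_binomial] at h
  rw [← h, variance_eq_integral (by fun_prop), ← integral_sum_pi_binomial]
  simp

end PoissonBinomial

namespace PBM

variable {d D n : ℕ} (A : PBM d D)

/-! ### The server's view before reduction -/

theorem sumLaw_ae_le (x : Dataset n d A.c) : ∀ᵐ s ∂(A.sumLaw x), ∀ j, s j ≤ n * A.m := by
  refine ae_all_iff.2 fun j => ?_
  refine (Measure.quasiMeasurePreserving_eval (fun j => (Measure.pi fun i => binomial A.m
    (A.prob (x.1 i) j)).map fun z => ∑ i, z i) j).ae (p := fun k => k ≤ n * A.m) ?_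
  rw [ae_map_iff measurable_sum.aemeasurable (by measurability)]
  have : ∀ᵐ z ∂(Measure.pi fun i => binomial A.m (A.prob (x.1 i) j)), ∀ i, z i ≤ A.m := by
    refine ae_all_iff.2 fun i => ?_
    refine (Measure.quasiMeasurePreserving_eval (fun i => binomial A.m (A.prob (x.1 i) j)) i).ae (p := fun k => k ≤ A.m) ?_
    exact ae_le_of_hasLaw_binomial (HasLaw.id (μ := binomial A.m (A.prob (x.1 i) j)))
  filter_upwards [this] with z hz
  calc ∑ i, z i ≤ ∑ _i : Fin n, A.m := sum_le_sum fun i _ => hz i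
    _ = n * A.m := by simp

/-- The sums are almost surely at most `n * m`, which is below the modulus: no overflow. -/
theorem val_reduce_ae (x : Dataset n d A.c) :
    ∀ᵐ s ∂(A.sumLaw x), (fun j => (A.reduce n s j).val) = s := by
  filter_upwards [A.sumLaw_ae_le x] with s hs
  funext j
  exact ZMod.val_natCast_of_lt (Nat.lt_succ_of_le (hs j))

theorem measurable_reduce : Measurable (A.reduce n) := measurable_of_countable _

instance (x : Dataset n d A.c) : IsProbabilityMeasure (A.aggLaw x) := by
  rw [aggLaw_eq_map_sumLaw]
  exact Measure.isProbabilityMeasure_map A.measurable_reduce.aemeasurable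

instance : Finite (A.MsgGroup n) := by
  have : NeZero (A.modulus n) := ⟨Nat.succ_ne_zero _⟩
  infer_instance

/-- Almost surely the sums are recovered from their residues, so every function is, up to a null
set, a function on a finite group. -/
theorem integrable_sumLaw {E : Type*} [NormedAddCommGroup E] (x : Dataset n d A.c)
    (f : (Fin D → ℕ) → E) : Integrable f (A.sumLaw x) := by
  have h : Integrable (fun t : A.MsgGroup n => f fun j => (t j).val) ((A.sumLaw x).map (A.reduce n)) := by
    rw [← aggLaw_eq_map_sumLaw]
    exact .of_finite
  refine (h.comp_measurable A.measurable_reduce).congr ?_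
  filter_upwards [A.val_reduce_ae x] with s hs
  simp only [Function.comp]
  rw [hs]

theorem measurable_decode : Measurable (A.decode (n := n)) := measurable_of_countable _

/-- The estimate as a function of the exact sums. -/
def estimate (n : ℕ) (s : Fin D → ℕ) : Vec d :=
  ∑ j, (A.c' / (A.m * n * A.θ) * ((s j : ℝ) - A.m * n / 2)) • A.u j

theorem memLp_outputLaw (x : Dataset n d A.c) (q : ENNReal) : MemLp id q (A.outputLaw x) := by
  rw [outputLaw, memLp_map_measure_iff (by fun_prop) A.measurable_decode.aemeasurable]
  exact .of_discrete

theorem integral_outputLaw {E : Type*} [NormedAddCommGroup E] [NormedSpace ℝ E]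
    (x : Dataset n d A.c) {F : Vec d → E} (hF : Continuous F) [SecondCountableTopologyEither (Vec d) E] :
    ∫ v, F v ∂(A.outputLaw x) = ∫ s, F (A.estimate n s) ∂(A.sumLaw x) := by
  rw [outputLaw, integral_map A.measurable_decode.aemeasurable hF.aestronglyMeasurable,
    aggLaw_eq_map_sumLaw, integral_map A.measurable_reduce.aemeasurable .of_discrete]
  refine integral_congr_ae ?_
  filter_upwards [A.val_reduce_ae x] with s hs
  congr 1
  refine sum_congr rfl fun j _ => ?_
  rw [congrFun hs j]

theorem integral_sumLaw_eval (x : Dataset n d A.c) (j : Fin D) (f : ℕ → ℝ) :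
    ∫ s, f (s j) ∂(A.sumLaw x) =
      ∫ z, f (∑ i, z i) ∂(Measure.pi fun i => binomial A.m (A.prob (x.1 i) j)) := by
  rw [← integral_map (φ := fun z : Fin n → ℕ => ∑ i, z i) measurable_sum.aemeasurable .of_discrete]
  have := (measurePreserving_eval (fun j => (Measure.pi fun i => binomial A.m
    (A.prob (x.1 i) j)).map fun z => ∑ i, z i) j).map_eq
  conv_rhs => rw [← this]
  rw [integral_map (measurable_pi_apply j).aemeasurable .of_discrete]
  rfl

/-! ### Accuracy -/

variable {A}

/-- The mean has the averaged Kashin coefficients as frame coefficients, so the error becomes a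
linear image of the centered sums; bias and variance follow coordinatewise. -/
theorem estimate_sub_mean (hn : 0 < n) (hm : 0 < A.m) (hθ : 0 < A.θ) (hc : 0 < A.c')
    (x : Dataset n d A.c)
    (hprob : ∀ i j, (A.prob (x.1 i) j : ℝ) = A.θ / A.c' * A.rep (x.1 i) j + 1 / 2)
    (hrep : ∀ i, x.1 i = ∑ j, A.rep (x.1 i) j • A.u j) (s : Fin D → ℕ) :
    A.estimate n s - datasetMean x = ∑ j, (A.c' / (A.m * n * A.θ) *
      ((s j : ℝ) - A.m * ∑ i, (A.prob (x.1 i) j : ℝ))) • A.u j := by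
  have hmean : datasetMean x = ∑ j, ((n : ℝ)⁻¹ * ∑ i, A.rep (x.1 i) j) • A.u j := by
    rw [datasetMean]
    conv_lhs => rw [sum_congr rfl fun i _ => hrep i]
    rw [sum_comm, smul_sum]
    refine sum_congr rfl fun j _ => ?_
    rw [← sum_smul, smul_smul]
  rw [estimate, hmean, ← sum_sub_distrib]
  refine sum_congr rfl fun j _ => ?_
  rw [← sub_smul]
  congr 1
  simp only [hprob, sum_add_distrib, ← mul_sum, sum_const, card_univ, Fintype.card_fin, nsmul_eq_mul]
  have : (0 : ℝ) < n := by exact_mod_cast hn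
  have : (0 : ℝ) < A.m := by exact_mod_cast hm
  field_simp
  ring

theorem integral_outputLaw_eq_mean (hn : 0 < n) (hm : 0 < A.m) (hθ : 0 < A.θ) (hc : 0 < A.c')
    (x : Dataset n d A.c)
    (hprob : ∀ i j, (A.prob (x.1 i) j : ℝ) = A.θ / A.c' * A.rep (x.1 i) j + 1 / 2)
    (hrep : ∀ i, x.1 i = ∑ j, A.rep (x.1 i) j • A.u j) :
    ∫ v, v ∂(A.outputLaw x) = datasetMean x := by
  rw [A.integral_outputLaw x continuous_id', ← sub_eq_zero]
  have : ∫ s, A.estimate n s ∂(A.sumLaw x) - datasetMean x =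
      ∫ s, (A.estimate n s - datasetMean x) ∂(A.sumLaw x) := by
    rw [integral_sub (A.integrable_sumLaw x _) (A.integrable_sumLaw x _)]
    simp
  rw [this]
  simp only [estimate_sub_mean hn hm hθ hc x hprob hrep]
  rw [integral_finsetSum _ fun j _ => A.integrable_sumLaw x _]
  refine sum_eq_zero fun j _ => ?_
  rw [integral_smul_const, integral_const_mul,
    A.integral_sumLaw_eval x j fun k => (k : ℝ) - A.m * ∑ i, (A.prob (x.1 i) j : ℝ)]
  have hint : Integrable (fun z : Fin n → ℕ => ((∑ i, z i : ℕ) : ℝ))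
      (Measure.pi fun i => binomial A.m (A.prob (x.1 i) j)) := by
    push_cast
    exact integrable_finsetSum _ fun i _ =>
      (measurePreserving_eval (fun i => binomial A.m (A.prob (x.1 i) j)) i).integrable_comp_of_integrable
        (integrable_binomial fun k : ℕ => (k : ℝ))
  rw [integral_sub hint (integrable_const _), integral_sum_pi_binomial]
  simp

/-- The contraction property is used pointwise, before integrating, so only the marginal variances
enter, each at most `n m / 4`. -/
theorem integral_outputLaw_sq_le (hn : 0 < n) (hm : 0 < A.m) (hθ : 0 < A.θ) (hc : 0 < A.c')
    (hu : IsTightFrame A.u) (x : Dataset n d A.c)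
    (hprob : ∀ i j, (A.prob (x.1 i) j : ℝ) = A.θ / A.c' * A.rep (x.1 i) j + 1 / 2)
    (hrep : ∀ i, x.1 i = ∑ j, A.rep (x.1 i) j • A.u j) :
    ∫ v, ‖v - datasetMean x‖ ^ 2 ∂(A.outputLaw x) ≤ D * A.c' ^ 2 / (4 * n * (A.m * A.θ ^ 2)) := by
  rw [A.integral_outputLaw x (F := fun v => ‖v - datasetMean x‖ ^ 2) (by fun_prop)]
  have hn' : (0 : ℝ) < n := by exact_mod_cast hn
  have hm' : (0 : ℝ) < A.m := by exact_mod_cast hm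
  calc _ ≤ ∫ s, ∑ j, (A.c' / (A.m * n * A.θ)) ^ 2 *
        (((s j : ℕ) : ℝ) - A.m * ∑ i, (A.prob (x.1 i) j : ℝ)) ^ 2 ∂(A.sumLaw x) := by
        refine integral_mono (A.integrable_sumLaw x _) (A.integrable_sumLaw x _) fun s => ?_
        simp only [estimate_sub_mean hn hm hθ hc x hprob hrep, ← mul_pow]
        exact hu.norm_sum_smul_sq_le _
    _ = ∑ j, (A.c' / (A.m * n * A.θ)) ^ 2 *
        ∑ i, A.m * (A.prob (x.1 i) j : ℝ) * (1 - A.prob (x.1 i) j) := by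
        rw [integral_finsetSum _ fun j _ => A.integrable_sumLaw x _]
        refine sum_congr rfl fun j _ => ?_
        rw [integral_const_mul, A.integral_sumLaw_eval x j
          fun k => ((k : ℝ) - A.m * ∑ i, (A.prob (x.1 i) j : ℝ)) ^ 2,
          integral_sum_pi_binomial_sub_sq]
    _ ≤ ∑ _j : Fin D, (A.c' / (A.m * n * A.θ)) ^ 2 * ∑ _i : Fin n, (A.m * (1 / 4) : ℝ) := by
        refine sum_le_sum fun j _ => mul_le_mul_of_nonneg_left (sum_le_sum fun i _ => ?_)
          (sq_nonneg _)
        rw [mul_assoc]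
        refine mul_le_mul_of_nonneg_left ?_ hm'.le
        nlinarith [sq_nonneg ((A.prob (x.1 i) j : ℝ) - 1 / 2)]
    _ = D * A.c' ^ 2 / (4 * n * (A.m * A.θ ^ 2)) := by
        simp only [sum_const, card_univ, Fintype.card_fin, nsmul_eq_mul]
        field_simp

end PBM

/-! ### Admissibility of the probabilities and the size of the message group -/

namespace PBM

variable {d D n : ℕ} {A : PBM d D}

theorem c'_pos (hd : 1 ≤ d) (hc : 0 < A.c) (hK : 0 < A.K) : 0 < A.c' := by
  have : (0 : ℝ) < d := by exact_mod_cast hd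
  exact div_pos (mul_pos hc hK) (Real.sqrt_pos.2 this)

theorem abs_rep_le (hd : 1 ≤ d) (hK : 0 < A.K) (hu : IsTightFrame A.u)
    (hrep : ∀ v, ‖v‖ ≤ A.c → IsKashinRep A.u A.K v (A.rep v)) {v : Vec d} (hv : ‖v‖ ≤ A.c)
    (j : Fin D) : |A.rep v j| ≤ A.c' := by
  have hd' : (0 : ℝ) < d := by exact_mod_cast hd
  have hD : (d : ℝ) ≤ D := by exact_mod_cast hu.dim_le
  calc |A.rep v j| ≤ A.K / √(D : ℝ) * ‖v‖ := (hrep v hv).2 j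
    _ ≤ A.K / √(d : ℝ) * A.c := by
      have := Real.sqrt_pos.2 hd'
      gcongr
    _ = A.c' := by rw [c']; ring

theorem prob_spec (hd : 1 ≤ d) (hc : 0 < A.c) (hK : 0 < A.K) (hθ0 : 0 < A.θ) (hθ1 : A.θ ≤ 1 / 4)
    (hu : IsTightFrame A.u) (hrep : ∀ v, ‖v‖ ≤ A.c → IsKashinRep A.u A.K v (A.rep v))
    {v : Vec d} (hv : ‖v‖ ≤ A.c) (j : Fin D) :
    (A.prob v j : ℝ) = A.θ / A.c' * A.rep v j + 1 / 2 ∧ |(A.prob v j : ℝ) - 1 / 2| ≤ A.θ := by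
  have hc' := c'_pos (A := A) hd hc hK
  have h1 : |A.θ / A.c' * A.rep v j| ≤ A.θ := by
    rw [abs_mul, abs_of_pos (div_pos hθ0 hc'), div_mul_eq_mul_div, div_le_iff₀ hc']
    exact mul_le_mul_of_nonneg_left (abs_rep_le hd hK hu hrep hv j) hθ0.le
  have h2 := abs_le.1 h1
  have h3 : (A.prob v j : ℝ) = A.θ / A.c' * A.rep v j + 1 / 2 := by
    rw [prob, Set.projIcc_of_mem zero_le_one (by constructor <;> linarith [h2.1, h2.2])]
  exact ⟨h3, by rw [h3, add_sub_cancel_right]; exact h1⟩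

theorem commBits_eq (n : ℕ) : A.commBits n = D * Real.logb 2 (n * A.m + 1) := by
  rw [commBits, Nat.card_fun, Nat.card_zmod]
  push_cast
  rw [Nat.card_eq_fintype_card, Fintype.card_fin, Real.logb_pow]

end PBM

/-! ### Tuning of the parameters -/

theorem privacyRatio_pos {n d : ℕ} {ε δ : ℝ} (hn : 1 ≤ n) (hd : 1 ≤ d) (hε : 0 < ε) (hδ0 : 0 < δ)
    (hδ1 : δ < 1) : 0 < privacyRatio n d ε δ := by
  have : 0 < Real.log (1 / δ) := Real.log_pos (by rw [lt_div_iff₀ hδ0]; linarith)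
  have : (0 : ℝ) < n := by exact_mod_cast hn
  have : (0 : ℝ) < d := by exact_mod_cast hd
  unfold privacyRatio
  positivity

/-- The trade-off behind the choice of `m` and `θ`: `m θ²` is of the order of the ratio. -/
theorem ceil_mul_sq_min_bounds {r κ : ℝ} (hr : 0 < r) (hκ : 0 < κ) :
    (⌈r⌉₊ : ℝ) * (κ * min (1 / 4) √r) ^ 2 ≤ κ ^ 2 * r ∧
      κ ^ 2 * r / 16 ≤ (⌈r⌉₊ : ℝ) * (κ * min (1 / 4) √r) ^ 2 := by
  have hs := Real.sq_sqrt hr.le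
  have h1 : (1 : ℝ) ≤ ⌈r⌉₊ := by exact_mod_cast Nat.ceil_pos.2 hr
  have h2 := Nat.le_ceil r
  have h3 := Nat.ceil_lt_add_one hr.le
  have hκ2 : 0 < κ ^ 2 := by positivity
  have hmin0 : 0 ≤ min (1 / 4) √r := le_min (by norm_num) (Real.sqrt_nonneg r)
  have ha : (min (1 / 4) √r) ^ 2 ≤ 1 / 16 := by
    have := min_le_left (1 / 4) √r
    nlinarith
  have hb : (min (1 / 4) √r) ^ 2 ≤ r := by
    have := min_le_right (1 / 4) √r
    nlinarith
  rw [mul_pow]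
  constructor
  · rcases le_total r 1 with hr1 | hr1
    · have : (⌈r⌉₊ : ℝ) ≤ 1 := by exact_mod_cast Nat.ceil_le.2 (by exact_mod_cast hr1)
      have : (⌈r⌉₊ : ℝ) = 1 := le_antisymm this h1
      rw [this, one_mul]
      gcongr
    · calc (⌈r⌉₊ : ℝ) * (κ ^ 2 * min (1 / 4) √r ^ 2) ≤ (2 * r) * (κ ^ 2 * (1 / 16)) := by
            gcongr
            linarith
        _ ≤ κ ^ 2 * r := by nlinarith
  · rcases min_choice (1 / 4) √r with hm | hm
    · rw [hm]
      nlinarith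
    · rw [hm, hs]
      nlinarith [mul_le_mul_of_nonneg_right h1 (by positivity : 0 ≤ κ ^ 2 * r)]

/-- `n ⌈r⌉ + 1 ≤ n (r + 1) + 1 ≤ (n + r) ^ 2`, where the last inequality uses `n + 1 ≤ n ^ 2` and so
needs `n ≥ 2`. -/
theorem logb_comm_le {n : ℕ} (hn : 2 ≤ n) {r : ℝ} (hr : 0 < r) :
    Real.logb 2 (n * (⌈r⌉₊ : ℝ) + 1) ≤ 2 * Real.logb 2 (n + r) := by
  have hn' : (2 : ℝ) ≤ n := by exact_mod_cast hn
  have h3 := Nat.ceil_lt_add_one hr.le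
  rw [show (2 : ℝ) * Real.logb 2 (n + r) = Real.logb 2 ((n + r) ^ 2) by
    rw [Real.logb_pow]; norm_num]
  refine Real.logb_le_logb_of_le (by norm_num) (by positivity) ?_
  nlinarith [mul_le_mul_of_nonneg_left h3.le (by linarith : (0 : ℝ) ≤ n)]

/-- The choice of the order of the Rényi divergence. -/
theorem exp_renyi_le_delta {γ B κ δ ε : ℝ} {n d D m : ℕ} {θ : ℝ} (hγ : 0 < γ)
    (hκ : 0 < κ) (hκ0 : 8 * 96 ^ 2 * γ * (2 + B) * κ ^ 2 ≤ 1) (hδ0 : 0 < δ) (hδ1 : δ < 1)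
    (hn : 1 ≤ n) (hd : 1 ≤ d) (hD : (D : ℝ) ≤ γ * d) (hε : 0 < ε)
    (hεB : ε ≤ B * Real.log (1 / δ)) (hmθ : m * θ ^ 2 ≤ κ ^ 2 * privacyRatio n d ε δ) :
    ∃ l : ℕ, l ≠ 0 ∧ Real.exp (-(ε * l)) *
      Real.exp (m * D * (((l + 1) * (96 * θ)) ^ 2 / n)) ≤ δ := by
  have hL : 0 < Real.log (1 / δ) := Real.log_pos (by rw [lt_div_iff₀ hδ0]; linarith)
  set L := Real.log (1 / δ) with hLdef
  have hn' : (0 : ℝ) < n := by exact_mod_cast hn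
  have hd' : (0 : ℝ) < d := by exact_mod_cast hd
  have hpos : 0 < 2 * L / ε := by positivity
  -- This order puts `ε l` between `2 L` and `(2 + B) L`; the bound on `ε` controls the rounding.
  -- The Rényi factor then costs at most `exp (ε l / 2)`, leaving `exp (-(ε l) / 2) ≤ exp (-L) = δ`.
  refine ⟨⌈2 * L / ε⌉₊, (Nat.ceil_pos.2 hpos).ne', ?_⟩
  set l := ⌈2 * L / ε⌉₊ with hl
  have l1 : (1 : ℝ) ≤ l := by exact_mod_cast Nat.ceil_pos.2 hpos
  have hlow : 2 * L ≤ ε * l := by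
    have := Nat.le_ceil (2 * L / ε)
    rw [div_le_iff₀ hε] at this
    linarith
  have hup : ε * l ≤ (2 + B) * L := by
    have := Nat.ceil_lt_add_one hpos.le
    rw [← hl] at this
    calc ε * l ≤ ε * (2 * L / ε + 1) := by gcongr
      _ = 2 * L + ε := by field_simp
      _ ≤ _ := by linarith
  have main : m * D * (((l + 1) * (96 * θ)) ^ 2 / n) ≤ ε * l / 2 := by
    calc m * D * (((l + 1) * (96 * θ)) ^ 2 / n)
        = D * (l + 1) ^ 2 * 96 ^ 2 * (m * θ ^ 2) / n := by ring
      _ ≤ (γ * d) * (l + l) ^ 2 * 96 ^ 2 * (κ ^ 2 * privacyRatio n d ε δ) / n := by gcongr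
      _ = (8 * 96 ^ 2 * γ * κ ^ 2 * (ε * l)) * (ε * l) / (2 * L) := by
          rw [privacyRatio, ← hLdef]; field_simp; ring
      _ ≤ L * (ε * l) / (2 * L) := by
          gcongr
          calc 8 * 96 ^ 2 * γ * κ ^ 2 * (ε * l) ≤ 8 * 96 ^ 2 * γ * κ ^ 2 * ((2 + B) * L) := by gcongr
            _ = (8 * 96 ^ 2 * γ * (2 + B) * κ ^ 2) * L := by ring
            _ ≤ 1 * L := by gcongr
            _ = L := one_mul L
      _ = ε * l / 2 := by field_simp
  rw [← Real.exp_add]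
  calc Real.exp _ ≤ Real.exp (-L) := by gcongr; linarith
    _ = δ := by rw [hLdef, one_div, Real.log_inv, neg_neg, Real.exp_log hδ0]

theorem tunedPBM_guarantees {γ K : ℝ} (hγ : 0 < γ) (hK : 0 < K) :
    ∃ C₁ > (0 : ℝ), ∀ B > (0 : ℝ),
      ∃ κ₀ > (0 : ℝ), κ₀ ≤ 1 ∧ ∀ κ : ℝ, 0 < κ → κ ≤ κ₀ →
      ∀ δ : ℝ, 0 < δ → δ < 1 → ∃ C₂ > (0 : ℝ),
      ∀ (n d D : ℕ), 1 ≤ n → 1 ≤ d → (D : ℝ) ≤ γ * d →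
      ∀ (u : Fin D → Vec d) (rep : Vec d → Fin D → ℝ) (c ε : ℝ), 0 < c →
      IsTightFrame u → (∀ x, ‖x‖ ≤ c → IsKashinRep u K x (rep x)) →
      0 < ε → ε ≤ B * Real.log (1 / δ) →
      ∀ A : PBM d D, A = tunedPBM n κ ε δ c K u rep →
        IsApproxDP Neighboring (fun x : Dataset n d A.c => A.aggLaw x) ε δ ∧
        IsApproxDP Neighboring (fun x : Dataset n d A.c => A.outputLaw x) ε δ ∧
        (2 ≤ n → A.commBits n ≤ C₁ * (d * Real.logb 2 (n + privacyRatio n d ε δ))) ∧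
        ∀ x : Dataset n d A.c,
          MemLp id 2 (A.outputLaw x) ∧
          ∫ v, v ∂(A.outputLaw x) = datasetMean x ∧
          ∫ v, ‖v - datasetMean x‖ ^ 2 ∂(A.outputLaw x) ≤ C₂ * (c ^ 2 * d / (n ^ 2 * ε ^ 2)) := by
  refine ⟨2 * γ, by positivity, fun B hB => ?_⟩
  set T : ℝ := 8 * 96 ^ 2 * γ * (2 + B) with hT
  have hT0 : 0 < T := by positivity
  refine ⟨min 1 T⁻¹, by positivity, min_le_left _ _, fun κ hκ hκ0 δ hδ0 hδ1 => ?_⟩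
  have hκ1 : κ ≤ 1 := hκ0.trans (min_le_left _ _)
  have hκT : T * κ ^ 2 ≤ 1 := by
    have h1 : κ ≤ T⁻¹ := hκ0.trans (min_le_right _ _)
    calc T * κ ^ 2 = (T * κ) * κ := by ring
      _ ≤ (T * T⁻¹) * 1 := by gcongr
      _ = 1 := by field_simp
  have hL : 0 < Real.log (1 / δ) := Real.log_pos (by rw [lt_div_iff₀ hδ0]; linarith)
  -- The variance bound `D c'² / (4 n m θ²)` with `D ≤ γ d`, `c'² = c² K² / d` and `m θ² ≥ κ² r /
  -- 16`, where `r` is the privacy ratio.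
  refine ⟨4 * γ * K ^ 2 * Real.log (1 / δ) / κ ^ 2, by positivity, ?_⟩
  intro n d D hn hd hD u rep c ε hc hu hrep hε hεB A hA
  have hr := privacyRatio_pos (ε := ε) hn hd hε hδ0 hδ1
  have hmθ := ceil_mul_sq_min_bounds hr hκ
  have Am : A.m = ⌈privacyRatio n d ε δ⌉₊ := by rw [hA]; rfl
  have Aθ : A.θ = κ * min (1 / 4) √(privacyRatio n d ε δ) := by rw [hA]; rfl
  have Ac : A.c = c := by rw [hA]; rfl
  have AK : A.K = K := by rw [hA]; rfl
  have Au : A.u = u := by rw [hA]; rfl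
  have Ar : A.rep = rep := by rw [hA]; rfl
  rw [← Am, ← Aθ] at hmθ
  have hm : 0 < A.m := by rw [Am]; exact Nat.ceil_pos.2 hr
  have hθ0 : 0 < A.θ := by
    rw [Aθ]; exact mul_pos hκ (lt_min (by norm_num) (Real.sqrt_pos.2 hr))
  have hθ1 : A.θ ≤ 1 / 4 := by
    rw [Aθ]
    have h0 : 0 ≤ min (1 / 4) √(privacyRatio n d ε δ) :=
      le_min (by norm_num) (Real.sqrt_nonneg _)
    have h1 := min_le_left (1 / 4) √(privacyRatio n d ε δ)
    nlinarith
  have hAc : 0 < A.c := by rwa [Ac]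
  have hAK : 0 < A.K := by rwa [AK]
  have hAu : IsTightFrame A.u := by rwa [Au]
  have hArep : ∀ v, ‖v‖ ≤ A.c → IsKashinRep A.u A.K v (A.rep v) := by
    rw [Ac, AK, Au, Ar]; exact hrep
  have hc' := PBM.c'_pos hd hAc hAK
  have hprob := fun (v : Vec d) (hv : ‖v‖ ≤ A.c) j =>
    PBM.prob_spec hd hAc hAK hθ0 hθ1 hAu hArep hv j
  have hsum : IsApproxDP Neighboring (fun x : Dataset n d A.c => A.sumLaw x) ε δ := by
    obtain ⟨l, hl, hexp⟩ := exp_renyi_le_delta hγ hκ hκT hδ0 hδ1 hn hd hD hε hεB hmθ.1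
    refine A.isApproxDP_sumLaw (Δ := A.θ) hl (fun v hv j => ?_) hexp
    have h := abs_le.1 (hprob v hv j).2
    exact ⟨⟨by linarith [h.1], by linarith [h.2]⟩, (hprob v hv j).2⟩
  have hagg : IsApproxDP Neighboring (fun x : Dataset n d A.c => A.aggLaw x) ε δ := by
    simp only [PBM.aggLaw_eq_map_sumLaw]
    exact hsum.map A.measurable_reduce
  have hn' : (0 : ℝ) < n := by exact_mod_cast hn
  have hd' : (0 : ℝ) < d := by exact_mod_cast hd
  refine ⟨hagg, hagg.map A.measurable_decode, fun hn2 => ?_, fun x => ⟨A.memLp_outputLaw x 2, ?_, ?_⟩⟩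
  · rw [PBM.commBits_eq, Am]
    have hlog : 0 ≤ Real.logb 2 (n + privacyRatio n d ε δ) :=
      Real.logb_nonneg (by norm_num) (by
        have : (1 : ℝ) ≤ n := by exact_mod_cast hn
        linarith)
    calc (D : ℝ) * Real.logb 2 (n * (⌈privacyRatio n d ε δ⌉₊ : ℝ) + 1)
        ≤ D * (2 * Real.logb 2 (n + privacyRatio n d ε δ)) := by
          gcongr
          exact logb_comm_le hn2 hr
      _ ≤ (γ * d) * (2 * Real.logb 2 (n + privacyRatio n d ε δ)) := by gcongr
      _ = _ := by ring
  · exact PBM.integral_outputLaw_eq_mean hn hm hθ0 hc' x (fun i j => (hprob _ (x.2 i) j).1)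
      fun i => (hArep _ (x.2 i)).1
  · refine (PBM.integral_outputLaw_sq_le hn hm hθ0 hc' hAu x (fun i j => (hprob _ (x.2 i) j).1)
      fun i => (hArep _ (x.2 i)).1).trans ?_
    have hcsq : A.c' ^ 2 = c ^ 2 * K ^ 2 / d := by
      rw [PBM.c', div_pow, Real.sq_sqrt hd'.le, Ac, AK, mul_pow]
    rw [hcsq]
    calc (D : ℝ) * (c ^ 2 * K ^ 2 / d) / (4 * n * (A.m * A.θ ^ 2))
        ≤ (γ * d) * (c ^ 2 * K ^ 2 / d) / (4 * n * (κ ^ 2 * privacyRatio n d ε δ / 16)) := by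
          gcongr
          exact hmθ.2
      _ = _ := by
          rw [privacyRatio]
          field_simp
          ring

/-! ### Rademacher sums -/

/-- The sign encoded by a Boolean. -/
def boolSign (b : Bool) : ℝ := if b then 1 else -1

/-- The signed sum of the entries of `w`. -/
def signSum {d : ℕ} (s : Fin d → Bool) (w : Fin d → ℝ) : ℝ := ∑ i, boolSign (s i) * w i

theorem signSum_smul {d : ℕ} (s : Fin d → Bool) (t : ℝ) (w : Fin d → ℝ) :
    signSum s (fun i => t * w i) = t * signSum s w := by
  simp only [signSum, mul_sum]
  exact sum_congr rfl fun i _ => by ring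

/-- Probabilities over random signs are written as counts; `2 ^ d` is the number of sign vectors. -/
theorem sum_exp_signSum_le {d : ℕ} (w : Fin d → ℝ) :
    ∑ s : Fin d → Bool, Real.exp (signSum s w) ≤ 2 ^ d * Real.exp ((∑ i, w i ^ 2) / 2) := by
  have h := Fintype.prod_sum fun (i : Fin d) (b : Bool) => Real.exp (boolSign b * w i)
  simp only [signSum, Real.exp_sum, ← h]
  calc ∏ i, ∑ b, Real.exp (boolSign b * w i) ≤ ∏ i : Fin d, (2 * Real.exp (w i ^ 2 / 2)) := by
        refine prod_le_prod (fun i _ => sum_nonneg fun b _ => Real.exp_nonneg _) fun i _ => ?_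
        have := Real.cosh_le_exp_half_sq (w i)
        rw [Real.cosh_eq] at this
        simp only [Fintype.sum_bool, boolSign]
        simp only [if_true, one_mul, Bool.false_eq_true, if_false, neg_mul]
        linarith
    _ = _ := by
        rw [prod_mul_distrib, ← Real.exp_sum, sum_div]
        simp

theorem sum_signSum_succ {d : ℕ} (w : Fin (d + 1) → ℝ) (F : ℝ → ℝ) :
    ∑ s : Fin (d + 1) → Bool, F (signSum s w) =
      ∑ s : Fin d → Bool, (F (signSum s (Fin.tail w) + w 0) + F (signSum s (Fin.tail w) - w 0)) := by
  rw [← (Fin.consEquiv fun _ => Bool).sum_comp, Fintype.sum_prod_type, Fintype.sum_bool,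
    sum_add_distrib]
  congr 1 <;> refine sum_congr rfl fun s _ => ?_ <;> congr 1 <;>
    simp [signSum, Fin.sum_univ_succ, Fin.consEquiv, boolSign, Fin.tail] <;> ring

theorem sum_signSum_sq {d : ℕ} (w : Fin d → ℝ) :
    ∑ s : Fin d → Bool, signSum s w ^ 2 = 2 ^ d * ∑ i, w i ^ 2 := by
  induction d with
  | zero => simp [signSum]
  | succ d ih =>
    rw [sum_signSum_succ w (· ^ 2), Fin.sum_univ_succ]
    have : ∀ s : Fin d → Bool, (signSum s (Fin.tail w) + w 0) ^ 2 + (signSum s (Fin.tail w) - w 0) ^ 2 =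
        2 * signSum s (Fin.tail w) ^ 2 + 2 * w 0 ^ 2 := fun s => by ring
    simp only [this, sum_add_distrib, ← mul_sum, ih (Fin.tail w)]
    simp [Fin.tail]
    ring

theorem sum_signSum_pow_four_le {d : ℕ} (w : Fin d → ℝ) :
    ∑ s : Fin d → Bool, signSum s w ^ 4 ≤ 2 ^ d * (3 * (∑ i, w i ^ 2) ^ 2) := by
  induction d with
  | zero => simp [signSum]
  | succ d ih =>
    rw [sum_signSum_succ w (· ^ 4), Fin.sum_univ_succ]
    have : ∀ s : Fin d → Bool, (signSum s (Fin.tail w) + w 0) ^ 4 + (signSum s (Fin.tail w) - w 0) ^ 4 =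
        2 * signSum s (Fin.tail w) ^ 4 + 12 * w 0 ^ 2 * signSum s (Fin.tail w) ^ 2 + 2 * w 0 ^ 4 :=
      fun s => by ring
    have ih' := ih (Fin.tail w)
    simp only [this, sum_add_distrib, ← mul_sum, sum_signSum_sq]
    have e : ∑ i : Fin d, w i.succ ^ 2 = ∑ i, Fin.tail w i ^ 2 := rfl
    rw [e]
    simp only [sum_const, card_univ, Fintype.card_fun, Fintype.card_bool, Fintype.card_fin,
      nsmul_eq_mul]
    push_cast
    generalize ∑ i, Fin.tail w i ^ 2 = σ at *
    have h2 : (0 : ℝ) < 2 ^ d := by positivity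
    have h4 : 0 ≤ (2 : ℝ) ^ d * w 0 ^ 4 := by positivity
    rw [pow_succ (2 : ℝ) d]
    nlinarith

/-- An even quartic majorant, so that second and fourth moments suffice: for a unit vector they give
`1 - 1/3 + 3/18 = 5/6`. -/
theorem exp_neg_abs_le (u : ℝ) : Real.exp (-|u|) ≤ 1 - u ^ 2 / 3 + u ^ 4 / 18 := by
  rw [← sq_abs u, ← (show Even 4 by decide).pow_abs u]
  have hv := abs_nonneg u
  generalize |u| = v at *
  have h1 : Real.exp (-v) ≤ 1 / (1 + v) := by
    rw [Real.exp_neg, ← one_div]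
    exact one_div_le_one_div_of_le (by linarith) (by linarith [Real.add_one_le_exp v])
  refine h1.trans ?_
  rw [div_le_iff₀ (by linarith)]
  have key : 0 ≤ 1 - v / 3 - v ^ 2 / 3 + v ^ 3 / 18 + v ^ 4 / 18 := by
    nlinarith [sq_nonneg (v ^ 2 - 3), sq_nonneg (v - 7 / 4), mul_nonneg hv (sq_nonneg (v - 7 / 4)),
      sq_nonneg (v ^ 2 - 49 / 16)]
  nlinarith [mul_nonneg hv key]

theorem sum_exp_neg_abs_signSum_le {d : ℕ} (w : Fin d → ℝ) (hw : ∑ i, w i ^ 2 = 1) :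
    ∑ s : Fin d → Bool, Real.exp (-|signSum s w|) ≤ 2 ^ d * (5 / 6) := by
  have h4 := sum_signSum_pow_four_le w
  have h2 := sum_signSum_sq w
  rw [hw] at h4 h2
  calc ∑ s : Fin d → Bool, Real.exp (-|signSum s w|)
      ≤ ∑ s : Fin d → Bool, (1 - signSum s w ^ 2 / 3 + signSum s w ^ 4 / 18) :=
        sum_le_sum fun s _ => exp_neg_abs_le _
    _ ≤ _ := by
        rw [sum_add_distrib, sum_sub_distrib, ← sum_div, ← sum_div, h2]
        simp only [sum_const, card_univ, Fintype.card_fun, Fintype.card_bool, Fintype.card_fin,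
          nsmul_eq_mul]
        push_cast
        linarith

theorem card_filter_le_sum_exp {α : Type*} [Fintype α] (p : α → Prop) [DecidablePred p]
    (f : α → ℝ) (hf : ∀ a, p a → 0 ≤ f a) :
    ((univ.filter p).card : ℝ) ≤ ∑ a, Real.exp (f a) := by
  rw [← nsmul_one, ← sum_const]
  calc ∑ a ∈ univ.filter p, (1 : ℝ) ≤ ∑ a ∈ univ.filter p, Real.exp (f a) :=
        sum_le_sum fun a ha => Real.one_le_exp (hf a (mem_filter.1 ha).2)
    _ ≤ _ := sum_le_sum_of_subset_of_nonneg (filter_subset _ _) fun _ _ _ => Real.exp_nonneg _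

/-- Few sign matrices shrink the `ℓ¹` norm of a given vector. -/
theorem card_small_l1_le {N d : ℕ} (w : Fin d → ℝ) {r : ℝ} (hr : 0 < r) (hw : ∑ i, w i ^ 2 = r ^ 2) :
    ((univ.filter fun M : Fin N → Fin d → Bool => ∑ j, |signSum (M j) w| < N / 10 * r).card : ℝ)
      ≤ (2 ^ d) ^ N * (14 / 15) ^ N := by
  set w' : Fin d → ℝ := fun i => r⁻¹ * w i with hw'
  have h1 : ∑ i, w' i ^ 2 = 1 := by
    simp only [hw', mul_pow, ← mul_sum, hw]
    field_simp
  have hs : ∀ s : Fin d → Bool, |signSum s w'| = r⁻¹ * |signSum s w| := fun s => by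
    rw [hw', signSum_smul, abs_mul, abs_of_pos (inv_pos.2 hr)]
  refine (card_filter_le_sum_exp _ (fun M => ∑ j, (1 / 10 - |signSum (M j) w'|)) fun M hM => ?_).trans ?_
  · simp only [hs, sum_sub_distrib, ← mul_sum, sum_const, card_univ, Fintype.card_fin, nsmul_eq_mul]
    rw [sub_nonneg, inv_mul_le_iff₀ hr]
    linarith
  · have h := Fintype.prod_sum fun (_ : Fin N) (s : Fin d → Bool) =>
      Real.exp (1 / 10 - |signSum s w'|)
    simp only [Real.exp_sum, ← h, prod_const, card_univ, Fintype.card_fin]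
    rw [← mul_pow]
    refine pow_le_pow_left₀ (sum_nonneg fun s _ => Real.exp_nonneg _) ?_ N
    -- Each row contributes `exp (1/10) * 5/6`, and `28/25 * 5/6 = 14/15`.
    have he : Real.exp (1 / 10) ≤ 28 / 25 := by
      refine le_of_pow_le_pow_left₀ (n := 10) (by norm_num) (by norm_num) ?_
      rw [← Real.exp_nat_mul]
      norm_num
      exact Real.exp_one_lt_d9.le.trans (by norm_num)
    simp only [sub_eq_add_neg, Real.exp_add, ← mul_sum]
    calc Real.exp (1 / 10) * ∑ s : Fin d → Bool, Real.exp (-|signSum s w'|)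
        ≤ 28 / 25 * (2 ^ d * (5 / 6)) := by
          gcongr
          exact sum_exp_neg_abs_signSum_le w' h1
      _ = _ := by ring

/-- Few sign matrices have a large bilinear form at given vectors. -/
theorem card_large_bilin_le {N d : ℕ} (z : Fin N → ℝ) (w : Fin d → ℝ) (hz : ∑ j, z j ^ 2 ≤ 1)
    (hw : ∑ i, w i ^ 2 ≤ 1) :
    ((univ.filter fun M : Fin N → Fin d → Bool => 3 * √(N : ℝ) < ∑ j, z j * signSum (M j) w).card : ℝ)
      ≤ (2 ^ d) ^ N * Real.exp (-(9 / 2) * N) := by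
  -- `l` is both the threshold and the Chernoff parameter: `exp (l ^ 2 / 2 - l ^ 2) = exp (-(9 / 2)
  -- N)`.
  set l : ℝ := 3 * √(N : ℝ) with hl
  have hl0 : 0 ≤ l := by positivity
  have hl2 : l ^ 2 = 9 * N := by rw [hl, mul_pow, Real.sq_sqrt (by positivity)]; norm_num
  refine (card_filter_le_sum_exp _
    (fun M => (∑ j, signSum (M j) fun i => (l * z j) * w i) + -l ^ 2) fun M hM => ?_).trans ?_
  · have : ∑ j, signSum (M j) (fun i => (l * z j) * w i) = l * ∑ j, z j * signSum (M j) w := by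
      simp only [signSum_smul, mul_sum, mul_assoc]
    rw [this]
    nlinarith [mul_le_mul_of_nonneg_left hM.le hl0]
  · have h := Fintype.prod_sum fun (j : Fin N) (s : Fin d → Bool) =>
      Real.exp (signSum s fun i => (l * z j) * w i)
    simp only [Real.exp_add, Real.exp_sum, ← sum_mul, ← h]
    calc _ ≤ (∏ j : Fin N, (2 ^ d * Real.exp ((l * z j) ^ 2 / 2))) * Real.exp (-l ^ 2) := by
          refine mul_le_mul_of_nonneg_right (prod_le_prod
            (fun j _ => sum_nonneg fun s _ => Real.exp_nonneg _) fun j _ => ?_) (Real.exp_nonneg _)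
          refine (sum_exp_signSum_le _).trans ?_
          gcongr
          simp only [mul_pow _ (w _), ← mul_sum]
          exact mul_le_of_le_one_right (by positivity) hw
      _ = (2 ^ d) ^ N * Real.exp (l ^ 2 * (∑ j, z j ^ 2) / 2 + -l ^ 2) := by
          rw [prod_mul_distrib, ← Real.exp_sum, ← sum_div]
          simp only [mul_pow, ← mul_sum]
          rw [Real.exp_add]
          simp [mul_assoc]
      _ ≤ _ := by
          gcongr
          have : l ^ 2 * ∑ j, z j ^ 2 ≤ l ^ 2 * 1 := by gcongr
          linarith

/-! ### Nets of the unit ball -/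

/-- A `1/2`-separated subset of the ball of largest cardinality is a net. Doubling it gives a
1-separated set in the ball of radius 2, hence the bound `5 ^ d`. -/
theorem exists_half_net (d : ℕ) : ∃ T : Finset (Vec d), T.card ≤ 5 ^ d ∧ (∀ t ∈ T, ‖t‖ ≤ 1) ∧
    ∀ x : Vec d, ‖x‖ ≤ 1 → ∃ t ∈ T, ‖x - t‖ ≤ 1 / 2 := by
  classical
  let P : Finset (Vec d) → Prop := fun s =>
    (∀ c ∈ s, ‖c‖ ≤ 1) ∧ ∀ c ∈ s, ∀ e ∈ s, c ≠ e → 1 / 2 ≤ ‖c - e‖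
  have hP : ∀ s, P s → s.card ≤ 5 ^ d := fun s hs => by
    have hinj : Function.Injective fun x : Vec d => (2 : ℝ) • x :=
      smul_right_injective _ two_ne_zero
    have := Besicovitch.card_le_of_separated (s.image fun x => (2 : ℝ) • x)
      (by
        simp only [mem_image, forall_exists_index, and_imp, forall_apply_eq_imp_iff₂]
        intro c hc
        rw [norm_smul, Real.norm_two]
        linarith [hs.1 c hc])
      (by
        simp only [mem_image, forall_exists_index, and_imp, forall_apply_eq_imp_iff₂]
        intro c hc e he hne
        rw [← smul_sub, norm_smul, Real.norm_two]
        have := hs.2 c hc e he fun h => hne (by rw [h])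
        linarith)
    rwa [card_image_of_injective _ hinj, finrank_euclideanSpace_fin] at this
  have h0 : ∃ s, P s ∧ s.card = 0 := ⟨∅, ⟨by simp, by simp⟩, rfl⟩
  let k := Nat.findGreatest (fun k => ∃ s, P s ∧ s.card = k) (5 ^ d)
  obtain ⟨T, hT, hTk⟩ : ∃ s, P s ∧ s.card = k :=
    Nat.findGreatest_spec (P := fun k => ∃ s, P s ∧ s.card = k) (Nat.zero_le _) h0
  refine ⟨T, hP T hT, hT.1, fun x hx => ?_⟩
  by_contra! hcon
  have hxT : x ∉ T := fun h => by have := hcon x h; norm_num at this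
  have hins : P (insert x T) := by
    refine ⟨fun c hc => ?_, fun c hc e he hne => ?_⟩
    · rcases mem_insert.1 hc with rfl | hc
      exacts [hx, hT.1 c hc]
    · rcases mem_insert.1 hc with rfl | hc' <;> rcases mem_insert.1 he with rfl | he'
      · exact absurd rfl hne
      · exact (hcon e he').le
      · rw [norm_sub_rev]; exact (hcon c hc').le
      · exact hT.2 c hc' e he' hne
  have := Nat.le_findGreatest (P := fun k => ∃ s, P s ∧ s.card = k) (hP _ hins) ⟨_, hins, rfl⟩
  rw [card_insert_of_notMem hxT] at this
  change T.card + 1 ≤ k at this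
  omega

/-- Each refinement covers the balls of radius `(1/2) ^ k` by scaled copies of the half net. -/
theorem exists_fine_net (d k : ℕ) : ∃ T : Finset (Vec d), T.card ≤ 5 ^ (d * k) ∧
    ∀ x : Vec d, ‖x‖ ≤ 1 → ∃ t ∈ T, ‖x - t‖ ≤ (1 / 2) ^ k := by
  classical
  obtain ⟨T₁, hT₁, -, hcov⟩ := exists_half_net d
  induction k with
  | zero => exact ⟨{0}, by simp, fun x hx => ⟨0, by simp, by simpa using hx⟩⟩
  | succ k ih =>
    obtain ⟨T, hT, hTc⟩ := ih
    refine ⟨image₂ (fun a b => a + ((1 / 2 : ℝ) ^ k) • b) T T₁, ?_, fun x hx => ?_⟩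
    · refine (card_image₂_le _ _ _).trans ?_
      rw [Nat.mul_succ, pow_add]
      exact Nat.mul_le_mul hT hT₁
    · obtain ⟨a, ha, hax⟩ := hTc x hx
      have hk : (0 : ℝ) < (1 / 2) ^ k := by positivity
      obtain ⟨b, hb, hbx⟩ := hcov (((1 / 2 : ℝ) ^ k)⁻¹ • (x - a)) (by
        rw [norm_smul, norm_inv, Real.norm_of_nonneg hk.le, inv_mul_le_iff₀ hk]
        linarith)
      refine ⟨_, mem_image₂_of_mem ha hb, ?_⟩
      have : x - (a + ((1 / 2 : ℝ) ^ k) • b) =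
          ((1 / 2 : ℝ) ^ k) • ((((1 / 2 : ℝ) ^ k)⁻¹ • (x - a)) - b) := by
        rw [smul_sub, smul_inv_smul₀ hk.ne', sub_add_eq_sub_sub]
      rw [this, norm_smul, Real.norm_of_nonneg hk.le, pow_succ]
      gcongr

theorem norm_le_two_mul_of_net {N : ℕ} {T : Finset (Vec N)}
    (hT : ∀ x : Vec N, ‖x‖ ≤ 1 → ∃ t ∈ T, ‖x - t‖ ≤ 1 / 2) {v : Vec N} {M : ℝ}
    (h : ∀ z ∈ T, inner ℝ z v ≤ M) : ‖v‖ ≤ 2 * M := by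
  rcases eq_or_ne v 0 with rfl | hv
  · obtain ⟨t, ht, -⟩ := hT 0 (by simp)
    have := h t ht
    simp at this ⊢
    exact this
  · have hv0 : 0 < ‖v‖ := norm_pos_iff.2 hv
    obtain ⟨t, ht, htx⟩ := hT (‖v‖⁻¹ • v) (by
      rw [norm_smul, norm_inv, norm_norm, inv_mul_cancel₀ hv0.ne'])
    have e : inner ℝ (‖v‖⁻¹ • v) v = ‖v‖ := by
      rw [real_inner_smul_left, real_inner_self_eq_norm_sq]; field_simp
    have h1 : inner ℝ (‖v‖⁻¹ • v - t) v ≤ 1 / 2 * ‖v‖ :=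
      (real_inner_le_norm _ _).trans (by gcongr)
    rw [inner_sub_left, e] at h1
    linarith [h t ht]

theorem opNorm_le_two_mul_of_net {N d : ℕ} {T : Finset (Vec d)}
    (hT : ∀ x : Vec d, ‖x‖ ≤ 1 → ∃ t ∈ T, ‖x - t‖ ≤ 1 / 2) {L : Vec d →L[ℝ] Vec N} {M : ℝ}
    (h : ∀ y ∈ T, ‖L y‖ ≤ M) : ‖L‖ ≤ 2 * M := by
  have hM : 0 ≤ M := by
    obtain ⟨t, ht, -⟩ := hT 0 (by simp)
    exact (norm_nonneg _).trans (h t ht)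
  have : ‖L‖ ≤ M + 1 / 2 * ‖L‖ := by
    refine L.opNorm_le_of_unit_norm (by positivity) fun x hx => ?_
    obtain ⟨t, ht, htx⟩ := hT x hx.le
    calc ‖L x‖ = ‖L t + L (x - t)‖ := by rw [← map_add]; congr 2; abel
      _ ≤ ‖L t‖ + ‖L (x - t)‖ := norm_add_le _ _
      _ ≤ M + ‖L‖ * (1 / 2) := by
        gcongr
        · exact h t ht
        · exact (L.le_opNorm _).trans (by gcongr)
      _ = _ := by ring
  linarith

/-! ### Sign matrices with good `ℓ¹` and `ℓ²` behavior -/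

/-- The action of a sign matrix. -/
def signMap {N d : ℕ} (M : Fin N → Fin d → Bool) : Vec d →L[ℝ] Vec N :=
  LinearMap.toContinuousLinearMap (Matrix.toEuclideanLin (Matrix.of fun j i => boolSign (M j i)))

theorem signMap_apply {N d : ℕ} (M : Fin N → Fin d → Bool) (x : Vec d) (j : Fin N) :
    signMap M x j = signSum (M j) x := by
  simp [signMap, signSum, Matrix.mulVec, dotProduct, Matrix.toEuclideanLin]

/-- Union bound over nets. Bilinear forms: at most `25 ^ N` pairs, each failing with probability at
most `50 ^ (-N)`. Small `ℓ¹` norms: at most `5 ^ (9 d)` points, each failing with probability at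
most `(14/15) ^ (400 d)`. The failures total at most `1/2 + 1/4`. -/
theorem exists_good_signs {d : ℕ} (hd : 1 ≤ d) : ∃ M : Fin (400 * d) → Fin d → Bool,
    ‖signMap M‖ ≤ 12 * √((400 * d : ℕ) : ℝ) ∧
    ∀ x : Vec d, ((400 * d : ℕ) : ℝ) / 40 * ‖x‖ ≤ ∑ j, |signMap M x j| := by
  classical
  set N := 400 * d with hN
  obtain ⟨S, hS, hS1, hScov⟩ := exists_half_net N
  obtain ⟨T, hT, hT1, hTcov⟩ := exists_half_net d
  -- Accuracy `2 ^ (-9)`: a net point has norm at least `1/2`, so its `ℓ¹` image is at least `N /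
  -- 20`, and the approximation loses at most `12 N / 512 < N / 40`.
  obtain ⟨U, hU, hUcov⟩ := exists_fine_net d 9
  let bad₁ (p : Vec N × Vec d) : Finset (Fin N → Fin d → Bool) :=
    univ.filter fun M => 3 * √(N : ℝ) < ∑ j, p.1 j * signSum (M j) p.2
  let bad₂ (y : Vec d) : Finset (Fin N → Fin d → Bool) :=
    univ.filter fun M => ∑ j, |signSum (M j) y| < N / 10 * ‖y‖
  let bad := (S ×ˢ T).biUnion bad₁ ∪ (U.filter (· ≠ 0)).biUnion bad₂
  have hN1 : 1 ≤ N := by omega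
  have hΩ : (0 : ℝ) < (2 ^ d) ^ N := by positivity
  have c1 : (((S ×ˢ T).biUnion bad₁).card : ℝ) ≤ (2 ^ d) ^ N * (1 / 2) := by
    calc (((S ×ˢ T).biUnion bad₁).card : ℝ) ≤ ((∑ p ∈ S ×ˢ T, (bad₁ p).card : ℕ) : ℝ) := by
          exact_mod_cast card_biUnion_le
      _ = ∑ p ∈ S ×ˢ T, ((bad₁ p).card : ℝ) := by push_cast; rfl
      _ ≤ ∑ p ∈ S ×ˢ T, (2 ^ d) ^ N * Real.exp (-(9 / 2) * N) := by
          refine sum_le_sum fun p hp => ?_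
          rw [mem_product] at hp
          have hsq : ∀ {m : ℕ} (v : Vec m), ‖v‖ ≤ 1 → ∑ i, v i ^ 2 ≤ 1 := fun v hv => by
            rw [← EuclideanSpace.real_norm_sq_eq]
            exact pow_le_one₀ (norm_nonneg v) hv
          exact card_large_bilin_le p.1 p.2 (hsq _ (hS1 _ hp.1)) (hsq _ (hT1 _ hp.2))
      _ = (S.card * T.card : ℕ) * ((2 ^ d) ^ N * Real.exp (-(9 / 2) * N)) := by
          rw [sum_const, card_product, nsmul_eq_mul]
      _ ≤ (25 ^ N : ℕ) * ((2 ^ d) ^ N * (1 / 50) ^ N) := by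
          gcongr
          · calc S.card * T.card ≤ 5 ^ N * 5 ^ N := by
                  refine Nat.mul_le_mul hS (hT.trans (Nat.pow_le_pow_right (by norm_num) (by omega)))
              _ = 25 ^ N := by rw [← mul_pow]; norm_num
          · rw [mul_comm, Real.exp_nat_mul]
            gcongr
            have h1 := Real.exp_one_gt_d9
            have h2 : Real.exp (-(9 / 2)) ≤ Real.exp (-4) := by gcongr; norm_num
            have h3 : (50 : ℝ) ≤ Real.exp 4 := by
              rw [show (4 : ℝ) = (4 : ℕ) * 1 by norm_num, Real.exp_nat_mul]
              calc (50 : ℝ) ≤ 2.7 ^ 4 := by norm_num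
                _ ≤ _ := by gcongr; linarith
            refine h2.trans ?_
            rw [Real.exp_neg, ← one_div]
            exact one_div_le_one_div_of_le (by norm_num) h3
      _ = (2 ^ d) ^ N * (1 / 2) ^ N := by
          push_cast
          rw [mul_left_comm, ← mul_pow]
          norm_num
      _ ≤ (2 ^ d) ^ N * (1 / 2) := by
          gcongr
          exact pow_le_of_le_one (by norm_num) (by norm_num) (by omega)
  have c2 : (((U.filter (· ≠ 0)).biUnion bad₂).card : ℝ) ≤ (2 ^ d) ^ N * (1 / 4) := by
    calc (((U.filter (· ≠ 0)).biUnion bad₂).card : ℝ)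
        ≤ ((∑ y ∈ U.filter (· ≠ 0), (bad₂ y).card : ℕ) : ℝ) := by
          exact_mod_cast card_biUnion_le
      _ = ∑ y ∈ U.filter (· ≠ 0), ((bad₂ y).card : ℝ) := by push_cast; rfl
      _ ≤ ∑ y ∈ U.filter (· ≠ 0), (2 ^ d) ^ N * (14 / 15) ^ N := by
          refine sum_le_sum fun y hy => ?_
          exact card_small_l1_le y (norm_pos_iff.2 (mem_filter.1 hy).2)
            (EuclideanSpace.real_norm_sq_eq y).symm
      _ = ((U.filter (· ≠ 0)).card : ℝ) * ((2 ^ d) ^ N * (14 / 15) ^ N) := by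
          rw [sum_const, nsmul_eq_mul]
      _ ≤ ((5 ^ (d * 9) : ℕ) : ℝ) * ((2 ^ d) ^ N * (14 / 15) ^ N) := by
          gcongr
          exact (card_filter_le _ _).trans hU
      _ = (2 ^ d) ^ N * (5 ^ 9 * (14 / 15) ^ 400) ^ d := by
          push_cast
          have e : (14 / 15 : ℝ) ^ N = ((14 / 15) ^ 400) ^ d := by rw [hN, pow_mul]
          rw [mul_left_comm, e, mul_comm d 9, pow_mul (5 : ℝ), ← mul_pow]
      _ ≤ (2 ^ d) ^ N * (1 / 4) ^ d := by
          gcongr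
          have h10 : (14 / 15 : ℝ) ^ 10 ≤ 51 / 100 := by norm_num
          calc (5 : ℝ) ^ 9 * (14 / 15) ^ 400 = 5 ^ 9 * ((14 / 15) ^ 10) ^ 40 := by rw [← pow_mul]
            _ ≤ 5 ^ 9 * (51 / 100) ^ 40 := by gcongr
            _ ≤ 1 / 4 := by norm_num
      _ ≤ (2 ^ d) ^ N * (1 / 4) := by
          gcongr
          exact pow_le_of_le_one (by norm_num) (by norm_num) (by omega)
  obtain ⟨M, hM⟩ : ∃ M, M ∉ bad := by
    by_contra! hall
    have h1 : (Fintype.card (Fin N → Fin d → Bool) : ℝ) = (2 ^ d) ^ N := by simp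
    have h2 : bad = univ := eq_univ_of_forall hall
    have h3 : (bad.card : ℝ) = (2 ^ d) ^ N := by rw [h2, card_univ, h1]
    have h4 : (bad.card : ℝ) ≤ ((S ×ˢ T).biUnion bad₁).card + ((U.filter (· ≠ 0)).biUnion bad₂).card := by
      exact_mod_cast card_union_le _ _
    linarith
  simp only [bad, mem_union, mem_biUnion, not_or, not_exists, not_and, bad₁, bad₂, mem_filter,
    mem_univ, true_and, not_lt, mem_product, Prod.forall] at hM
  obtain ⟨hM1, hM2⟩ := hM
  -- Each of the two half nets costs a factor 2 on top of `3 √N`.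
  have hop : ‖signMap M‖ ≤ 12 * √(N : ℝ) := by
    have : ∀ y ∈ T, ‖signMap M y‖ ≤ 2 * (3 * √(N : ℝ)) := fun y hy =>
      norm_le_two_mul_of_net hScov fun z hz => by
        refine le_trans (le_of_eq ?_) (hM1 z y ⟨hz, hy⟩)
        rw [PiLp.inner_apply]
        refine sum_congr rfl fun j _ => ?_
        rw [signMap_apply]
        simp [mul_comm]
    calc ‖signMap M‖ ≤ 2 * (2 * (3 * √(N : ℝ))) := opNorm_le_two_mul_of_net hTcov this
      _ = _ := by ring
  have hl1 : ∀ x : Vec d, ∑ j, |signMap M x j| ≤ 12 * N * ‖x‖ := fun x => by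
    have h1 : (∑ j, |signMap M x j|) ^ 2 ≤ N * ‖signMap M x‖ ^ 2 := by
      have := sum_mul_sq_le_sq_mul_sq univ (fun _ : Fin N => (1 : ℝ)) fun j => |signMap M x j|
      simpa [EuclideanSpace.real_norm_sq_eq] using this
    have h2 : ‖signMap M x‖ ≤ 12 * √(N : ℝ) * ‖x‖ := (signMap M).le_of_opNorm_le hop x
    refine le_of_sq_le_sq (h1.trans ?_) (by positivity)
    calc (N : ℝ) * ‖signMap M x‖ ^ 2 ≤ N * (12 * √(N : ℝ) * ‖x‖) ^ 2 := by gcongr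
      _ = (12 * N * ‖x‖) ^ 2 := by
        rw [mul_pow, mul_pow, Real.sq_sqrt (by positivity)]; ring
  refine ⟨M, hop, fun x => ?_⟩
  have unit : ∀ v : Vec d, ‖v‖ = 1 → (N : ℝ) / 40 ≤ ∑ j, |signMap M v j| := fun v hv => by
    obtain ⟨y, hy, hyv⟩ := hUcov v hv.le
    have hyn : 1 / 2 ≤ ‖y‖ := by
      have := norm_sub_norm_le v y
      norm_num at hyv
      linarith
    have h1 := hM2 y ⟨hy, fun h => by rw [h, norm_zero] at hyn; norm_num at hyn⟩
    have h2 := hl1 (y - v)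
    rw [norm_sub_rev] at h2
    have h3 : ∑ j, |signMap M y j| ≤ ∑ j, |signMap M v j| + ∑ j, |signMap M (y - v) j| := by
      rw [← sum_add_distrib]
      refine sum_le_sum fun j _ => ?_
      rw [map_sub]
      simpa using abs_add_le (signMap M v j) (signMap M y j - signMap M v j)
    simp only [← signMap_apply] at h1
    have hN0 : (0 : ℝ) ≤ N := by positivity
    norm_num at hyv
    nlinarith [mul_le_mul_of_nonneg_left hyn hN0, mul_le_mul_of_nonneg_left hyv hN0]
  rcases eq_or_ne x 0 with rfl | hx
  · simp
  · have hx0 : 0 < ‖x‖ := norm_pos_iff.2 hx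
    have := unit (‖x‖⁻¹ • x) (by rw [norm_smul, norm_inv, norm_norm, inv_mul_cancel₀ hx0.ne'])
    simp only [map_smul, PiLp.smul_apply, smul_eq_mul, abs_mul, abs_inv, abs_norm, ← mul_sum] at this
    rwa [le_inv_mul_iff₀ hx0, mul_comm] at this

/-! ### Kashin frames -/

/-- Duality between lower `ℓ¹` bounds and representations with small coefficients. -/
theorem exists_small_coeffs {d D : ℕ} {u : Fin D → Vec d} {t : ℝ} (ht : 0 ≤ t)
    (h : ∀ y, ‖y‖ ≤ t * ∑ j, |inner ℝ (u j) y|) (x : Vec d) :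
    ∃ a : Fin D → ℝ, x = ∑ j, a j • u j ∧ ∀ j, |a j| ≤ t * ‖x‖ := by
  let Φ : (Fin D → ℝ) →ₗ[ℝ] Vec d := Fintype.linearCombination ℝ u
  have hΦ : ∀ a, Φ a = ∑ j, a j • u j := fun a => Fintype.linearCombination_apply ℝ u a
  have hΦc : Continuous Φ := Φ.continuous_of_finiteDimensional
  set Q : Set (Fin D → ℝ) := Set.Icc (fun _ => -t) (fun _ => t) with hQ
  have unit : ∀ v : Vec d, ‖v‖ = 1 → v ∈ Φ '' Q := fun v hv => by
    by_contra hmem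
    -- A functional `y` separating `v` from the image of the cube has supremum `t * ∑ j, |inner ℝ (u
    -- j) y|` there, attained at the sign pattern of the inner products. That would be less than
    -- `inner ℝ y v ≤ ‖y‖`, against `h`.
    obtain ⟨f, s, hf, hs⟩ := geometric_hahn_banach_closed_point
      ((convex_Icc _ _).linear_image Φ) ((isCompact_Icc.image hΦc).isClosed) hmem
    set y := (InnerProductSpace.toDual ℝ (Vec d)).symm f with hy
    have hfy : ∀ z, f z = inner ℝ y z := fun z => by
      rw [hy, InnerProductSpace.toDual_symm_apply]
    have h1 := hf (Φ fun j => if 0 ≤ inner ℝ (u j) y then t else -t) ⟨_, by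
      constructor <;> intro j <;> dsimp only <;> split_ifs <;> linarith, rfl⟩
    have h2 : f (Φ fun j => if 0 ≤ inner ℝ (u j) y then t else -t) =
        t * ∑ j, |inner ℝ (u j) y| := by
      rw [hΦ, map_sum, mul_sum]
      refine sum_congr rfl fun j _ => ?_
      rw [map_smul, hfy, real_inner_comm, smul_eq_mul]
      split_ifs with hj
      · rw [abs_of_nonneg hj]
      · rw [abs_of_neg (not_le.1 hj)]; ring
    have h3 : f v ≤ ‖y‖ := by
      rw [hfy]
      simpa [hv] using real_inner_le_norm y v
    linarith [h y]
  rcases eq_or_ne x 0 with rfl | hx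
  · exact ⟨0, by simp, by simp⟩
  · have hx0 : 0 < ‖x‖ := norm_pos_iff.2 hx
    obtain ⟨a, ha, hax⟩ := unit (‖x‖⁻¹ • x)
      (by rw [norm_smul, norm_inv, norm_norm, inv_mul_cancel₀ hx0.ne'])
    refine ⟨fun j => ‖x‖ * a j, ?_, fun j => ?_⟩
    · simp only [mul_smul, ← smul_sum]
      rw [← hΦ, hax, smul_inv_smul₀ hx0.ne']
    · rw [abs_mul, abs_norm, mul_comm]
      exact mul_le_mul_of_nonneg_right (abs_le.2 ⟨ha.1 j, ha.2 j⟩) hx0.le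

/-- A positive quadratic form is a sum of `d` squares of linear forms. -/
theorem exists_sum_inner_sq_eq {d : ℕ} (T : Vec d →L[ℝ] Vec d) (hT : T.IsPositive) :
    ∃ w : Fin d → Vec d, ∀ x, inner ℝ (T x) x = ∑ k, inner ℝ (w k) x ^ 2 := by
  have hfin : Module.finrank ℝ (Vec d) = d := finrank_euclideanSpace_fin
  set b := hT.isSymmetric.eigenvectorBasis hfin with hb
  set e := hT.isSymmetric.eigenvalues hfin with he
  have he0 : ∀ k, 0 ≤ e k := fun k => hT.toLinearMap.nonneg_eigenvalues hfin k
  refine ⟨fun k => √(e k) • b k, fun x => ?_⟩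
  rw [← b.sum_inner_mul_inner (T x) x]
  refine sum_congr rfl fun k _ => ?_
  have h1 : inner ℝ (T x) (b k) = e k * inner ℝ (b k) x := by
    have h2 : (T : Vec d →ₗ[ℝ] Vec d) (b k) = e k • b k :=
      hT.isSymmetric.apply_eigenvectorBasis hfin k
    have h3 : inner ℝ (T x) (b k) = inner ℝ x (T (b k)) := hT.isSymmetric x (b k)
    rw [h3, show T (b k) = e k • b k from h2, real_inner_smul_right, real_inner_comm]
  rw [h1, real_inner_smul_left, mul_pow, Real.sq_sqrt (he0 k)]
  ring

/-- A contraction is completed to an isometry by adding `d` coordinates. -/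
theorem exists_tight_completion {N d : ℕ} (u : Fin N → Vec d)
    (hu : ∀ x, ∑ j, inner ℝ (u j) x ^ 2 ≤ ‖x‖ ^ 2) :
    ∃ w : Fin d → Vec d, IsTightFrame (Fin.append u w) := by
  -- The defect of the frame identity is a positive quadratic form; writing it as `d` squares
  -- supplies the missing vectors.
  let T : Vec d →L[ℝ] Vec d := ContinuousLinearMap.id ℝ (Vec d) -
    ∑ j, InnerProductSpace.rankOne ℝ (u j) (u j)
  have hTx : ∀ x y, inner ℝ (T x) y = inner ℝ x y - ∑ j, inner ℝ (u j) x * inner ℝ (u j) y :=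
    fun x y => by
      simp only [T, _root_.sub_apply, ContinuousLinearMap.id_apply, inner_sub_left,
        _root_.sum_apply, InnerProductSpace.rankOne_apply, sum_inner,
        real_inner_smul_left]
  have hTxx : ∀ x, inner ℝ (T x) x = ‖x‖ ^ 2 - ∑ j, inner ℝ (u j) x ^ 2 := fun x => by
    rw [hTx, real_inner_self_eq_norm_sq]
    simp only [sq]
  have hpos : T.IsPositive := by
    rw [ContinuousLinearMap.isPositive_iff]
    refine ⟨fun x y => ?_, fun x => ?_⟩
    · change inner ℝ (T x) y = inner ℝ x (T y)
      rw [← real_inner_comm x (T y), hTx, hTx, real_inner_comm]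
      congr 1
      exact sum_congr rfl fun j _ => mul_comm _ _
    · rw [hTxx]; linarith [hu x]
  obtain ⟨w, hw⟩ := exists_sum_inner_sq_eq T hpos
  refine ⟨w, fun x => ?_⟩
  rw [Fin.sum_univ_add]
  simp only [Fin.append_left, Fin.append_right]
  rw [← hw x, hTxx]
  ring

theorem exists_kashin_frame {d : ℕ} (hd : 1 ≤ d) :
    ∃ (u : Fin (400 * d + d) → Vec d) (rep : Vec d → Fin (400 * d + d) → ℝ),
      IsTightFrame u ∧ ∀ x, IsKashinRep u 960 x (rep x) := by
  have hgood := exists_good_signs hd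
  generalize hN : 400 * d = N at hgood ⊢
  obtain ⟨M, hM1, hM2⟩ := hgood
  have hN0 : (0 : ℝ) < N := by exact_mod_cast (by omega : 0 < N)
  have hs : 0 < √(N : ℝ) := Real.sqrt_pos.2 hN0
  have hss : √(N : ℝ) * √(N : ℝ) = N := Real.mul_self_sqrt hN0.le
  let v : Fin N → Vec d := fun j => (12 * √(N : ℝ))⁻¹ • WithLp.toLp 2 fun i => boolSign (M j i)
  have hv : ∀ j x, inner ℝ (v j) x = (12 * √(N : ℝ))⁻¹ * signMap M x j := fun j x => by
    rw [real_inner_smul_left, signMap_apply, PiLp.inner_apply]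
    simp [signSum, mul_comm]
  obtain ⟨w, hw⟩ := exists_tight_completion v fun x => by
    simp only [hv, mul_pow, ← mul_sum]
    rw [← EuclideanSpace.real_norm_sq_eq, ← mul_pow]
    refine pow_le_pow_left₀ (by positivity) ?_ 2
    rw [inv_mul_le_iff₀ (by positivity)]
    exact (signMap M).le_of_opNorm_le hM1 x
  set u := Fin.append v w with hu
  -- `480 = 12 * 40`, from the operator norm and the `ℓ¹` bound; the completing vectors only enlarge
  -- the sum.
  have hl1 : ∀ y, ‖y‖ ≤ 480 / √(N : ℝ) * ∑ j, |inner ℝ (u j) y| := fun y => by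
    have h1 : ∑ j, |inner ℝ (v j) y| ≤ ∑ j, |inner ℝ (u j) y| := by
      rw [Fin.sum_univ_add]
      simp only [hu, Fin.append_left]
      exact le_add_of_nonneg_right (sum_nonneg fun _ _ => abs_nonneg _)
    have h2 : ∑ j, |inner ℝ (v j) y| = (12 * √(N : ℝ))⁻¹ * ∑ j, |signMap M y j| := by
      simp only [hv, abs_mul, ← mul_sum]
      rw [abs_of_pos (by positivity)]
    calc ‖y‖ = 480 / √(N : ℝ) * ((12 * √(N : ℝ))⁻¹ * (N / 40 * ‖y‖)) := by
          field_simp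
          rw [sq, hss]
          ring
      _ ≤ 480 / √(N : ℝ) * ∑ j, |inner ℝ (u j) y| := by
          gcongr
          refine le_trans ?_ (h2 ▸ h1)
          gcongr
          exact hM2 y
  choose rep hrep1 hrep2 using exists_small_coeffs (by positivity) hl1
  refine ⟨u, rep, hw, fun x => ⟨hrep1 x, fun j => (hrep2 x j).trans ?_⟩⟩
  gcongr ?_ * _
  -- The level refers to all `N + d` vectors; replacing `√N` by `√(N + d) ≤ 2 √N` doubles 480 to
  -- 960.
  have hle : √((N + d : ℕ) : ℝ) ≤ 2 * √(N : ℝ) := by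
    rw [Real.sqrt_le_left (by positivity), mul_pow, Real.sq_sqrt hN0.le]
    exact_mod_cast (by omega : N + d ≤ 2 ^ 2 * N)
  have hpos : 0 < √((N + d : ℕ) : ℝ) := Real.sqrt_pos.2 (by exact_mod_cast (by omega : 0 < N + d))
  rw [div_le_div_iff₀ hs hpos]
  linarith

end

theorem mainTheorem4 :
    -- Kashin frames with `D = O(d)` and `K = O(1)`, as the mechanism needs them, exist.
    (∃ γ > (0 : ℝ), ∃ K > (0 : ℝ), ∀ d : ℕ, 1 ≤ d →
      ∃ D : ℕ, (D : ℝ) ≤ γ * d ∧ ∃ (u : Fin D → Vec d) (rep : Vec d → Fin D → ℝ),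
        IsTightFrame u ∧ ∀ x, IsKashinRep u K x (rep x)) ∧
    -- For all such frames the mechanism has the claimed privacy, cost and accuracy.
    (∀ γ > (0 : ℝ), ∀ K > (0 : ℝ), ∃ C₁ > (0 : ℝ), ∀ B > (0 : ℝ),
      ∃ κ₀ > (0 : ℝ), κ₀ ≤ 1 ∧ ∀ κ : ℝ, 0 < κ → κ ≤ κ₀ →
      ∀ δ : ℝ, 0 < δ → δ < 1 → ∃ C₂ > (0 : ℝ),
      ∀ (n d D : ℕ), 1 ≤ n → 1 ≤ d → (D : ℝ) ≤ γ * d →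
      ∀ (u : Fin D → Vec d) (rep : Vec d → Fin D → ℝ) (c ε : ℝ), 0 < c →
      IsTightFrame u → (∀ x, ‖x‖ ≤ c → IsKashinRep u K x (rep x)) →
      0 < ε → ε ≤ B * Real.log (1 / δ) →
      ∀ A : PBM d D, A = tunedPBM n κ ε δ c K u rep →
        -- privacy of the server's view and of the output
        IsApproxDP Neighboring (fun x : Dataset n d A.c => A.aggLaw x) ε δ ∧
        IsApproxDP Neighboring (fun x : Dataset n d A.c => A.outputLaw x) ε δ ∧
        -- communication
        (2 ≤ n → A.commBits n ≤ C₁ * (d * Real.logb 2 (n + privacyRatio n d ε δ))) ∧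
        -- unbiasedness and mean squared error
        ∀ x : Dataset n d A.c,
          MemLp id 2 (A.outputLaw x) ∧
          ∫ v, v ∂(A.outputLaw x) = datasetMean x ∧
          ∫ v, ‖v - datasetMean x‖ ^ 2 ∂(A.outputLaw x) ≤ C₂ * (c ^ 2 * d / (n ^ 2 * ε ^ 2))) := by
  refine ⟨⟨401, by norm_num, 960, by norm_num, fun d hd => ⟨400 * d + d, ?_, exists_kashin_frame hd⟩⟩,
    fun γ hγ K hK => tunedPBM_guarantees hγ hK⟩
  push_cast
  linarith
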